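/- Let $n\ge 0$ and let $\lambda=(\lambda_1,\dots,\lambda_{n+1})\in\mathbb{C}^{n+1}$ satisfy $\sum_{i=1}^{n+1}\lambda_i=0$. Let $\tilde A_n$ be the cyclic quiver with vertices $1,\dots,n+1$ and exactly one arrow $\alpha_i\colon i\to i+1$ for each vertex $i$ (indices modulo $n+1$), and let $\Pi^\lambda(\tilde A_n)$ be its deformed preprojective algebra over $\mathbb{C}$: the quotient of the path algebra of the doubled quiver (an arrow $\alpha^*\colon j\to i$ is added for each arrow $\alpha\colon i\to j$; products of arrows are read as compositions of maps) by the relations $$\sum_{s(\alpha)=i}\alpha^*\alpha-\sum_{t(\beta)=i}\beta\beta^*+\lambda_i e_i=0\qquad(1\le i\le n+1),$$ where $\alpha,\beta$ run over the arrows of $\tilde A_n$, $s$ and $t$ are source and target, and $e_i$ is the trivial path at $i$. Put $\Lambda_i=\lambda_1+\cdots+\lambda_i$ for $1\le i\le n+1$, and let $P\in\mathbb{C}[Z]$ be a polynomial of degree $n+1$ whose roots, counted with multiplicity, are $\Lambda_1,\dots,\Lambda_{n+1}$. Then: 1. There is an isomorphism of $\mathbb{C}$-algebras $$e_{n+1}\,\Pi^\lambda(\tilde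 A_n)\,e_{n+1}\;\cong\;\mathbb{C}[X,Y,Z]/(XY-P(Z)).$$ 2. One has $\lambda_l+\lambda_{l+1}+\cdots+\lambda_k\ne 0$ for all $1\le l\le k\le n$ if and only if the roots $\Lambda_1,\dots,\Lambda_{n+1}$ of $P$ are pairwise distinct. 3. Suppose that the equivalent conditions of (2) hold. Let $X_{\mathrm{Mil}}=\operatorname{Spec}\mathbb{C}[X,Y,Z]/(XY-P(Z))$ be the affine Milnor fibre $\{XY=P(Z)\}$. For a $\mathbb{C}$-algebra $A$ write $D^b(A)$ for the bounded derived category of the category of finitely generated right $A$-modules. (The ring $\Pi^\lambda(\tilde A_n)$ is right Noetherian since $\sum_i\lambda_i=0$, so this category is abelian for $A=\Pi^\lambda(\tilde A_n)$.) Then there are equivalences of $\mathbb{C}$-linear triangulated categories $$D^b\bigl(\mathbb{C}[X,Y,Z]/(XY-P(Z))\bigr)\simeq D^b\bigl(\Pi^\lambda(\tilde A_n)\bigr)\qquad\text{and}\qquad D^b(\mathrm{Coh}(X_{\mathrm{Mil}}))\simeq D^b\bigl(\Pi^\lambda(\tilde A_n)\bigr).$$ -/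

import Mathlib

open CategoryTheory

/-! ## Path algebras and deformed preprojective algebras -/

/-- Generators of the path algebra of a quiver: the trivial paths and the arrows. -/
inductive PathGen (V : Type) [Quiver.{0} V] : Type
  | idem (i : V) : PathGen V
  | arrow {i j : V} (a : i ⟶ j) : PathGen V

/-- Relations of the path algebra of a finite quiver: the trivial paths `e i` are orthogonal
idempotents with sum `1`, and `e j * a = a = a * e i` for an arrow `a : i ⟶ j`. Thus products of
arrows are read like compositions of maps, and the paths form a basis of the quotient. -/
inductive PathRel (k : Type) [Field k] (V : Type) [Fintype V] [Quiver.{0} V] :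
    FreeAlgebra k (PathGen V) → FreeAlgebra k (PathGen V) → Prop
  | idem_mul_self (i : V) : PathRel k V
      (FreeAlgebra.ι k (.idem i) * FreeAlgebra.ι k (.idem i)) (FreeAlgebra.ι k (.idem i))
  | idem_mul_idem {i j : V} (h : i ≠ j) : PathRel k V
      (FreeAlgebra.ι k (.idem i) * FreeAlgebra.ι k (.idem j)) 0
  | sum_idem : PathRel k V (∑ i, FreeAlgebra.ι k (.idem i)) 1
  | target {i j : V} (a : i ⟶ j) : PathRel k V
      (FreeAlgebra.ι k (.idem j) * FreeAlgebra.ι k (.arrow a)) (FreeAlgebra.ι k (.arrow a))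
  | source {i j : V} (a : i ⟶ j) : PathRel k V
      (FreeAlgebra.ι k (.arrow a) * FreeAlgebra.ι k (.idem i)) (FreeAlgebra.ι k (.arrow a))

/-- The path algebra `k V` of a finite quiver `V`. -/
def PathAlgebra (k : Type) [Field k] (V : Type) [Fintype V] [Quiver.{0} V] : Type :=
  RingQuot (PathRel k V)

namespace PathAlgebra

variable (k : Type) [Field k] {V : Type} [Fintype V] [Quiver.{0} V]

noncomputable instance : Ring (PathAlgebra k V) := inferInstanceAs (Ring (RingQuot (PathRel k V)))

noncomputable instance : Algebra k (PathAlgebra k V) :=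
  inferInstanceAs (Algebra k (RingQuot (PathRel k V)))

/-- The trivial path at the vertex `i`. -/
noncomputable def e (i : V) : PathAlgebra k V :=
  RingQuot.mkAlgHom k (PathRel k V) (FreeAlgebra.ι k (.idem i))

/-- The path of length one given by an arrow. -/
noncomputable def arrow {i j : V} (a : i ⟶ j) : PathAlgebra k V :=
  RingQuot.mkAlgHom k (PathRel k V) (FreeAlgebra.ι k (.arrow a))

theorem e_mul_self (i : V) : e k i * e k i = e k i := by
  have h := RingQuot.mkAlgHom_rel k (PathRel.idem_mul_self (k := k) i)
  rw [map_mul] at h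
  exact h

theorem e_mul_e {i j : V} (h : i ≠ j) : e k i * e k j = 0 := by
  have h := RingQuot.mkAlgHom_rel k (PathRel.idem_mul_idem (k := k) h)
  rw [map_mul, map_zero] at h
  exact h

theorem sum_e : ∑ i : V, e k i = 1 := by
  have h := RingQuot.mkAlgHom_rel k (PathRel.sum_idem (k := k) (V := V))
  rw [map_sum, map_one] at h
  exact h

theorem e_mul_arrow {i j : V} (a : i ⟶ j) : e k j * arrow k a = arrow k a := by
  have h := RingQuot.mkAlgHom_rel k (PathRel.target (k := k) a)
  rw [map_mul] at h
  exact h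

theorem arrow_mul_e {i j : V} (a : i ⟶ j) : arrow k a * e k i = arrow k a := by
  have h := RingQuot.mkAlgHom_rel k (PathRel.source (k := k) a)
  rw [map_mul] at h
  exact h

end PathAlgebra

instance (V : Type) [Fintype V] : Fintype (Quiver.Symmetrify V) := inferInstanceAs (Fintype V)

section Preprojective

variable (k : Type) [Field k] (V : Type) [Fintype V] [Quiver.{0} V]
  [∀ i j : V, Fintype (i ⟶ j)]

namespace PathAlgebra

variable {V}

/-- The trivial path at `i`, in the path algebra of the doubled quiver. -/
noncomputable def de (i : V) : PathAlgebra k (Quiver.Symmetrify V) :=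
  e k (V := Quiver.Symmetrify V) i

/-- An arrow `a : i ⟶ j` of the quiver, in the path algebra of the doubled quiver. -/
noncomputable def darrow {i j : V} (a : i ⟶ j) : PathAlgebra k (Quiver.Symmetrify V) :=
  arrow k (V := Quiver.Symmetrify V) (i := i) (j := j) (Sum.inl a)

/-- The arrow `a* : j ⟶ i` opposite to `a : i ⟶ j`, in the path algebra of the doubled quiver. -/
noncomputable def dstar {i j : V} (a : i ⟶ j) : PathAlgebra k (Quiver.Symmetrify V) :=
  arrow k (V := Quiver.Symmetrify V) (i := j) (j := i) (Sum.inr a)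

end PathAlgebra

open PathAlgebra

/-- The relations
`∑_{s(a) = i} a* a - ∑_{t(b) = i} b b* + lam i • e i = 0`, one for every vertex `i`. -/
inductive PreprojectiveRel (lam : V → k) :
    PathAlgebra k (Quiver.Symmetrify V) → PathAlgebra k (Quiver.Symmetrify V) → Prop
  | vertex (i : V) : PreprojectiveRel lam
      (∑ j : V, ∑ a : i ⟶ j, dstar k a * darrow k a
        - ∑ j : V, ∑ b : j ⟶ i, darrow k b * dstar k b + lam i • de k i) 0

/-- The deformed preprojective algebra `Π^lam` of a finite quiver. -/
def DeformedPreprojective (lam : V → k) : Type := RingQuot (PreprojectiveRel k V lam)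

namespace DeformedPreprojective

variable {k V} (lam : V → k)

noncomputable instance : Ring (DeformedPreprojective k V lam) :=
  inferInstanceAs (Ring (RingQuot (PreprojectiveRel k V lam)))

noncomputable instance : Algebra k (DeformedPreprojective k V lam) :=
  inferInstanceAs (Algebra k (RingQuot (PreprojectiveRel k V lam)))

/-- The quotient map from the path algebra of the doubled quiver. -/
noncomputable def mk :
    PathAlgebra k (Quiver.Symmetrify V) →ₐ[k] DeformedPreprojective k V lam :=
  RingQuot.mkAlgHom k (PreprojectiveRel k V lam)

/-- The idempotent of a vertex in the deformed preprojective algebra. -/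
noncomputable def e (i : V) : DeformedPreprojective k V lam := mk lam (de k i)

theorem isIdempotentElem_e (i : V) : IsIdempotentElem (e lam i) := by
  unfold IsIdempotentElem e
  rw [← map_mul]
  exact congrArg _ (e_mul_self k (V := Quiver.Symmetrify V) i)

end DeformedPreprojective

end Preprojective

/-! ## The corner algebra `e A e` -/

namespace IsIdempotentElem

variable {k A : Type} [Field k] [Ring A] [Algebra k A] {e : A} (he : IsIdempotentElem e)

/-- The `k`-algebra structure of the corner ring `e A e` (whose unit is `e`). -/
noncomputable instance instAlgebraCorner : Algebra k he.Corner where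
  smul c x := ⟨c • x.1, by
    rw [Subsemigroup.mem_corner_iff he, mul_smul_comm, smul_mul_assoc]
    have := (Subsemigroup.mem_corner_iff he).mp x.2
    exact ⟨by rw [this.1], by rw [this.2]⟩⟩
  algebraMap :=
    { toFun := fun c => ⟨c • e, by
        rw [Subsemigroup.mem_corner_iff he, mul_smul_comm, smul_mul_assoc, he.eq]
        exact ⟨rfl, rfl⟩⟩
      map_one' := Subtype.ext (one_smul k e)
      map_mul' := fun c d => Subtype.ext (by
        change (c * d) • e = (c • e) * (d • e)
        rw [smul_mul_smul_comm, he.eq])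
      map_zero' := Subtype.ext (zero_smul k e)
      map_add' := fun c d => Subtype.ext (add_smul c d e) }
  commutes' c x := Subtype.ext (by
    have := (Subsemigroup.mem_corner_iff he).mp x.2
    change (c • e) * x.1 = x.1 * (c • e)
    rw [mul_smul_comm, smul_mul_assoc, this.1, this.2])
  smul_def' c x := Subtype.ext (by
    have := (Subsemigroup.mem_corner_iff he).mp x.2
    change c • x.1 = (c • e) * x.1
    rw [smul_mul_assoc, this.1])

end IsIdempotentElem

/-! ## The cyclically oriented quiver of type `Ã_n` -/

/-- The vertices `0, …, n` of the cyclic quiver with `n + 1` vertices. -/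
def CyclicQuiver (n : ℕ) : Type := Fin (n + 1)

namespace CyclicQuiver

instance (n : ℕ) : Fintype (CyclicQuiver n) := inferInstanceAs (Fintype (Fin (n + 1)))

instance (n : ℕ) : DecidableEq (CyclicQuiver n) := inferInstanceAs (DecidableEq (Fin (n + 1)))

instance (n : ℕ) : AddCommGroup (CyclicQuiver n) := inferInstanceAs (AddCommGroup (Fin (n + 1)))

instance (n : ℕ) : One (CyclicQuiver n) := inferInstanceAs (One (Fin (n + 1)))

/-- There is exactly one arrow `i ⟶ i + 1` for every vertex `i` (cyclically), and no other. -/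
instance (n : ℕ) : Quiver.{0} (CyclicQuiver n) where
  Hom i j := PLift (j = i + 1)

instance (n : ℕ) (i j : CyclicQuiver n) : Fintype (i ⟶ j) :=
  inferInstanceAs (Fintype (PLift (j = i + 1)))

end CyclicQuiver

/-! ## Noetherianity

Elements `E i`, `a`, `b` of an algebra that satisfy the relations of `Π^lam(Ã_n)` (with `a` and `b`
the sums of all arrows and of all opposite arrows) and generate it. Such an algebra is Noetherian
when `∑ i, lam i = 0`; this is only used to see that finitely generated modules form an abelian
category. -/

/-- Generators of an algebra that satisfy the relations of `Π^lam(Ã_n)`. -/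
structure CyclicTriple {k B : Type} [Field k] [Ring B] [Algebra k B] {n : ℕ}
    (lam : Fin (n + 1) → k) (E : Fin (n + 1) → B) (a b : B) : Prop where
  idem : ∀ i, E i * E i = E i
  orth : ∀ i j, i ≠ j → E i * E j = 0
  sum_idem : ∑ i, E i = 1
  a_mul : ∀ i, a * E i = E (i + 1) * a
  mul_b : ∀ i, E i * b = b * E (i + 1)
  comm : a * b = b * a + ∑ i, lam i • E i
  adjoin : Algebra.adjoin k (insert a (insert b (Set.range E))) = ⊤

namespace CyclicTriple
open MulOpposite
open scoped Fin.CommRing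

variable {k B : Type} [Field k] [Ring B] [Algebra k B] {n : ℕ}
  {lam : Fin (n + 1) → k} {E : Fin (n + 1) → B} {a b : B}

theorem opposite (h : CyclicTriple lam E a b) :
    CyclicTriple lam (fun i => op (E i)) (op b) (op a) where
  idem i := by rw [← op_mul, h.idem]
  orth i j hij := by rw [← op_mul, h.orth _ _ hij.symm, op_zero]
  sum_idem := by rw [← Finset.op_sum, h.sum_idem, op_one]
  a_mul i := by rw [← op_mul, ← op_mul, h.mul_b]
  mul_b i := by rw [← op_mul, ← op_mul, h.a_mul]
  comm := by
    rw [← op_mul, h.comm, MulOpposite.op_add, op_mul, Finset.op_sum]; simp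
  adjoin := by
    have := congrArg Subalgebra.op h.adjoin
    rw [Subalgebra.op_adjoin, Subalgebra.op_top] at this
    rw [← this]
    congr 1
    ext x
    simp only [Set.mem_insert_iff, Set.mem_range, Set.mem_preimage]
    constructor
    · rintro (rfl | rfl | ⟨i, rfl⟩) <;> simp
    · rintro (h | h | ⟨i, h⟩)
      · right; left; rw [← h]; simp
      · left; rw [← h]; simp
      · right; right; exact ⟨i, by rw [h]; simp⟩

theorem E_mul_sum (h : CyclicTriple lam E a b) (f : Fin (n + 1) → k) (i : Fin (n + 1)) :
    E i * ∑ j, f j • E j = f i • E i := by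
  rw [Finset.mul_sum, Finset.sum_eq_single i]
  · rw [mul_smul_comm, h.idem]
  · intro j _ hj; rw [mul_smul_comm, h.orth _ _ hj.symm, smul_zero]
  · simp

theorem sum_mul_E (h : CyclicTriple lam E a b) (f : Fin (n + 1) → k) (i : Fin (n + 1)) :
    (∑ j, f j • E j) * E i = f i • E i := by
  rw [Finset.sum_mul, Finset.sum_eq_single i]
  · rw [smul_mul_assoc, h.idem]
  · intro j _ hj; rw [smul_mul_assoc, h.orth _ _ hj, smul_zero]
  · simp

theorem a_mul_sum (h : CyclicTriple lam E a b) (f : Fin (n + 1) → k) :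
    a * ∑ i, f i • E i = (∑ i, f (i - 1) • E i) * a := by
  rw [Finset.mul_sum, Finset.sum_mul]
  refine Fintype.sum_equiv (Equiv.addRight 1) _ _ fun i => ?_
  simp [h.a_mul]

theorem pow_mul_E (h : CyclicTriple lam E a b) (p : ℕ) (i : Fin (n + 1)) :
    a ^ p * E i = E (i + (p : Fin (n + 1))) * a ^ p := by
  induction p generalizing i with
  | zero => simp
  | succ p ih => rw [pow_succ, mul_assoc, h.a_mul, ← mul_assoc, ih, mul_assoc]; push_cast; congr 2; ring

theorem pow_mul_b (h : CyclicTriple lam E a b) (p : ℕ) :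
    a ^ (p + 1) * b = b * a ^ (p + 1) +
      (∑ i, (∑ j ∈ Finset.range (p + 1), lam (i - (j : Fin (n + 1)))) • E i) * a ^ p := by
  induction p with
  | zero => simp [h.comm]
  | succ p ih =>
    have key : ∑ i, (∑ j ∈ Finset.range (p + 1 + 1), lam (i - (j : Fin (n + 1)))) • E i =
        ∑ i, lam i • E i +
          ∑ i, (∑ j ∈ Finset.range (p + 1), lam (i - 1 - (j : Fin (n + 1)))) • E i := by
      rw [← Finset.sum_add_distrib (s := (Finset.univ : Finset (Fin (n + 1))))]
      refine Finset.sum_congr rfl fun i _ => ?_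
      rw [← add_smul, Finset.sum_range_succ' _ (p + 1), add_comm]
      congr 2
      · simp
      · refine Finset.sum_congr rfl fun j _ => ?_
        congr 1; push_cast; ring
    rw [pow_succ' a (p + 1), mul_assoc, ih, mul_add, ← mul_assoc, ← mul_assoc, h.comm, h.a_mul_sum,
      key, add_mul, add_mul, mul_assoc b, ← pow_succ', add_assoc, mul_assoc _ a, ← pow_succ']

theorem pow_comm_E (h : CyclicTriple lam E a b) (i : Fin (n + 1)) :
    Commute (a ^ (n + 1)) (E i) := by
  have := h.pow_mul_E (n + 1) i
  rwa [Fin.natCast_self, add_zero] at this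

theorem pow_comm_b (h : CyclicTriple lam E a b) (hlam : ∑ i, lam i = 0) :
    Commute (a ^ (n + 1)) b := by
  have h1 := h.pow_mul_b n
  have h2 : ∀ i : Fin (n + 1),
      ∑ j ∈ Finset.range (n + 1), lam (i - (j : Fin (n + 1))) = 0 := by
    intro i
    rw [← Fin.sum_univ_eq_sum_range (fun j => lam (i - (j : Fin (n + 1))))]
    simp only [Fin.cast_val_eq_self]
    rw [← hlam]
    exact Fintype.sum_equiv (Equiv.subLeft i) _ _ fun _ => rfl
  simpa [h2, Commute, SemiconjBy] using h1

/-- The central element `b a + ∑ (lam 0 + ⋯ + lam i) E i`. -/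
def zeta {k B : Type} [Field k] [Ring B] [Algebra k B] {n : ℕ}
    (lam : Fin (n + 1) → k) (E : Fin (n + 1) → B) (a b : B) : B :=
  b * a + ∑ i, (∑ j ∈ Finset.Iic i, lam j) • E i

theorem partial_succ (hlam : ∑ i, lam i = 0) (i : Fin (n + 1)) :
    ∑ j ∈ Finset.Iic i, lam j = lam i + ∑ j ∈ Finset.Iic (i - 1), lam j := by
  rcases Fin.eq_zero_or_eq_succ i with rfl | ⟨j, rfl⟩
  · have h0 : (0 - 1 : Fin (n + 1)) = Fin.last n := by
      rw [zero_sub, eq_comm, eq_neg_iff_add_eq_zero]; simp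
    have h1 : Finset.Iic (Fin.last n) = Finset.univ := by ext; simp [Fin.le_last]
    have h2 : Finset.Iic (0 : Fin (n + 1)) = {0} := by ext; simp
    rw [h0, h1, hlam, h2]; simp
  · have h0 : (j.succ - 1 : Fin (n + 1)) = j.castSucc := by
      rw [sub_eq_iff_eq_add]; simp
    have h1 : Finset.Iic j.succ = insert j.succ (Finset.Iic j.castSucc) := by
      ext x
      simp only [Finset.mem_Iic, Finset.mem_insert, Fin.le_def, Fin.ext_iff, Fin.val_succ,
        Fin.val_castSucc]
      omega
    rw [h0, h1, Finset.sum_insert]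
    simp [Fin.le_def]

theorem zeta_comm_a (h : CyclicTriple lam E a b) (hlam : ∑ i, lam i = 0) :
    Commute (zeta lam E a b) a := by
  unfold zeta Commute SemiconjBy
  have key : ∑ i, (∑ j ∈ Finset.Iic i, lam j) • E i =
      ∑ i, lam i • E i + ∑ i, (∑ j ∈ Finset.Iic (i - 1), lam j) • E i := by
    rw [← Finset.sum_add_distrib (s := (Finset.univ : Finset (Fin (n + 1))))]
    refine Finset.sum_congr rfl fun i _ => ?_
    rw [← add_smul, ← partial_succ hlam]
  rw [mul_add, h.a_mul_sum, ← mul_assoc, h.comm, key]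
  simp only [add_mul, add_assoc]

theorem zeta_comm_E (h : CyclicTriple lam E a b) (i : Fin (n + 1)) :
    Commute (zeta lam E a b) (E i) := by
  unfold zeta Commute SemiconjBy
  rw [mul_add, add_mul, h.E_mul_sum, h.sum_mul_E, mul_assoc, h.a_mul, ← mul_assoc, ← h.mul_b,
    mul_assoc]

theorem op_zeta : MulOpposite.op (zeta lam E a b) =
    zeta lam (fun i => MulOpposite.op (E i)) (MulOpposite.op b) (MulOpposite.op a) := by
  simp [zeta]

theorem zeta_comm_b (h : CyclicTriple lam E a b) (hlam : ∑ i, lam i = 0) :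
    Commute (zeta lam E a b) b := by
  have := h.opposite.zeta_comm_a hlam
  rw [← op_zeta] at this
  exact this.unop

theorem mem_center (h : CyclicTriple lam E a b) {x : B} (ha : Commute x a) (hb : Commute x b)
    (hE : ∀ i, Commute x (E i)) : x ∈ Subalgebra.center k B := by
  rw [Subalgebra.mem_center_iff]
  intro y
  have hy : y ∈ Algebra.adjoin k (insert a (insert b (Set.range E))) := by
    rw [h.adjoin]; trivial
  refine Algebra.adjoin_induction (p := fun y _ => y * x = x * y) ?_ ?_ ?_ ?_ hy
  · rintro y (rfl | rfl | ⟨i, rfl⟩)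
    · exact ha.symm
    · exact hb.symm
    · exact (hE i).symm
  · intro r; exact Algebra.commutes r x
  · intro y z _ _ hy hz; rw [add_mul, mul_add, hy, hz]
  · intro y z _ _ hy hz; rw [mul_assoc, hz, ← mul_assoc, hy, mul_assoc]

theorem isNoetherianRing (h : CyclicTriple lam E a b) (hlam : ∑ i, lam i = 0) :
    IsNoetherianRing B := by
  classical
  have hX : a ^ (n + 1) ∈ Subalgebra.center k B :=
    h.mem_center (Commute.pow_self a _) (h.pow_comm_b hlam) h.pow_comm_E
  have hY : b ^ (n + 1) ∈ Subalgebra.center k B :=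
    h.mem_center (by simpa using (h.opposite.pow_comm_b hlam).unop) (Commute.pow_self b _)
      (fun i => by simpa using (h.opposite.pow_comm_E i).unop)
  have hZ : zeta lam E a b ∈ Subalgebra.center k B :=
    h.mem_center (h.zeta_comm_a hlam) (h.zeta_comm_b hlam) h.zeta_comm_E
  let φ : MvPolynomial (Fin 3) k →ₐ[k] Subalgebra.center k B :=
    MvPolynomial.aeval ![⟨_, hX⟩, ⟨_, hY⟩, ⟨_, hZ⟩]
  let ψ : MvPolynomial (Fin 3) k →ₐ[k] B := (Subalgebra.center k B).val.comp φ
  have hψX : ψ (MvPolynomial.X 0) = a ^ (n + 1) := by simp [ψ, φ]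
  have hψY : ψ (MvPolynomial.X 1) = b ^ (n + 1) := by simp [ψ, φ]
  have hψZ : ψ (MvPolynomial.X 2) = zeta lam E a b := by simp [ψ, φ]
  have hψ : ∀ r x, ψ r * x = x * ψ r := fun r x =>
    (Subalgebra.mem_center_iff.mp (φ r).2 x).symm
  let _ : Algebra (MvPolynomial (Fin 3) k) B := ψ.toRingHom.toAlgebra' hψ
  have hsmul : ∀ (r : MvPolynomial (Fin 3) k) (x : B), r • x = ψ r * x := fun _ _ => rfl
  let g : Fin (n + 1) × Fin (n + 1) × Fin (n + 1) → B :=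
    fun t => E t.1 * a ^ (t.2.1 : ℕ) * b ^ (t.2.2 : ℕ)
  let S : Submodule (MvPolynomial (Fin 3) k) B := Submodule.span _ (Set.range g)
  have hg : ∀ (i : Fin (n + 1)) (p q : ℕ), p ≤ n → q ≤ n → E i * a ^ p * b ^ q ∈ S :=
    fun i p q hp hq => Submodule.subset_span
      ⟨(i, ⟨p, Nat.lt_succ_of_le hp⟩, ⟨q, Nat.lt_succ_of_le hq⟩), rfl⟩
  have hk : ∀ (c : k) (x : B), x ∈ S → c • x ∈ S := by
    intro c x hx
    have : c • x = (MvPolynomial.C c : MvPolynomial (Fin 3) k) • x := by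
      rw [hsmul, ← MvPolynomial.algebraMap_eq, AlgHom.commutes, Algebra.smul_def]
    rw [this]; exact S.smul_mem _ hx
  -- `S` is stable under left multiplication by anything stabilising the generators
  have stab : ∀ y : B, (∀ t, y * g t ∈ S) → ∀ x ∈ S, y * x ∈ S := by
    intro y hy x hx
    induction hx using Submodule.span_induction with
    | mem x hx => obtain ⟨t, rfl⟩ := hx; exact hy t
    | zero => simp
    | add x z _ _ hx hz => rw [mul_add]; exact S.add_mem hx hz
    | smul r x _ hx =>
      rw [mul_smul_comm]; exact S.smul_mem _ hx
  have hE : ∀ j t, E j * g t ∈ S := by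
    rintro j ⟨i, p, q⟩
    simp only [g]
    rw [← mul_assoc, ← mul_assoc]
    by_cases hij : j = i
    · subst hij; rw [h.idem]; exact hg _ _ _ (by omega) (by omega)
    · rw [h.orth _ _ hij]; simp
  have ha : ∀ t, a * g t ∈ S := by
    rintro ⟨i, p, q⟩
    simp only [g]
    rw [← mul_assoc, ← mul_assoc, h.a_mul, mul_assoc (E (i + 1)), ← pow_succ']
    by_cases hp : (p : ℕ) + 1 ≤ n
    · exact hg _ _ _ hp (by omega)
    · have hp' : (p : ℕ) + 1 = n + 1 := by omega
      have : E (i + 1) * a ^ ((p : ℕ) + 1) * b ^ (q : ℕ) =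
          (MvPolynomial.X 0 : MvPolynomial (Fin 3) k) • (E (i + 1) * a ^ 0 * b ^ (q : ℕ)) := by
        rw [hp', hsmul, hψX, pow_zero, mul_one, ← mul_assoc, (h.pow_comm_E (i + 1)).eq]
      rw [this]
      exact S.smul_mem _ (hg _ _ _ (by omega) (by omega))
  have hb : ∀ t, b * g t ∈ S := by
    rintro ⟨i, p, q⟩
    simp only [g]
    obtain ⟨i, rfl⟩ : ∃ j, i = j + 1 := ⟨i - 1, by simp⟩
    rw [← mul_assoc, ← mul_assoc, ← h.mul_b]
    rcases Nat.eq_zero_or_pos (p : ℕ) with hp | hp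
    · rw [hp, pow_zero, mul_one, mul_assoc, ← pow_succ']
      by_cases hq : (q : ℕ) + 1 ≤ n
      · simpa using hg i 0 _ (by omega) hq
      · have hq' : (q : ℕ) + 1 = n + 1 := by omega
        have : E i * b ^ ((q : ℕ) + 1) =
            (MvPolynomial.X 1 : MvPolynomial (Fin 3) k) • (E i * a ^ 0 * b ^ 0) := by
          rw [hq', hsmul, hψ, hψY]; simp
        rw [this]
        exact S.smul_mem _ (hg _ _ _ (by omega) (by omega))
    · obtain ⟨r, hr⟩ : ∃ r, (p : ℕ) = r + 1 := ⟨p - 1, by omega⟩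
      have hba : E i * (b * a) =
          zeta lam E a b * E i - (∑ j ∈ Finset.Iic i, lam j) • E i := by
        rw [(h.zeta_comm_E i).eq, zeta, mul_add, h.E_mul_sum, add_sub_cancel_right]
      have : E i * b * a ^ (p : ℕ) * b ^ (q : ℕ) =
          (MvPolynomial.X 2 : MvPolynomial (Fin 3) k) • (E i * a ^ r * b ^ (q : ℕ)) -
            (∑ j ∈ Finset.Iic i, lam j) • (E i * a ^ r * b ^ (q : ℕ)) := by
        rw [hr, pow_succ', hsmul, hψZ, mul_assoc (E i) b, ← mul_assoc b, ← mul_assoc (E i), hba,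
          sub_mul, sub_mul, smul_mul_assoc, smul_mul_assoc, mul_assoc _ (E i), mul_assoc _ (E i * _)]
      rw [this]
      exact S.sub_mem (S.smul_mem _ (hg _ _ _ (by omega) (by omega)))
        (hk _ _ (hg _ _ _ (by omega) (by omega)))
  have h1 : (1 : B) ∈ S := by
    rw [← h.sum_idem]
    exact S.sum_mem fun i _ => by simpa using hg i 0 0 (by omega) (by omega)
  have htop : S = ⊤ := by
    rw [eq_top_iff]
    intro y _
    have hy : y ∈ Algebra.adjoin k (insert a (insert b (Set.range E))) := by
      rw [h.adjoin]; trivial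
    suffices H : ∀ x ∈ S, y * x ∈ S by simpa using H 1 h1
    refine Algebra.adjoin_induction (p := fun y _ => ∀ x ∈ S, y * x ∈ S) ?_ ?_ ?_ ?_ hy
    · rintro y (rfl | rfl | ⟨i, rfl⟩)
      · exact stab _ ha
      · exact stab _ hb
      · exact stab _ (hE i)
    · intro r x hx; rw [← Algebra.smul_def]; exact hk _ _ hx
    · intro y z _ _ hy hz x hx; rw [add_mul]; exact S.add_mem (hy x hx) (hz x hx)
    · intro y z _ _ hy hz x hx; rw [mul_assoc]; exact hy _ (hz x hx)
  have : Module.Finite (MvPolynomial (Fin 3) k) B :=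
    ⟨⟨Finset.univ.image g, by rw [Finset.coe_image, Finset.coe_univ, Set.image_univ]; exact htop⟩⟩
  exact IsNoetherianRing.of_finite (MvPolynomial (Fin 3) k) B

end CyclicTriple

namespace CyclicQuiver
open PathAlgebra DeformedPreprojective

variable {n : ℕ} (lam : CyclicQuiver n → ℂ)

/-- The idempotents. -/
noncomputable def E (i : CyclicQuiver n) : DeformedPreprojective ℂ (CyclicQuiver n) lam :=
  DeformedPreprojective.e (V := CyclicQuiver n) lam i

/-- The arrow from `i` to `i + 1`. -/
noncomputable def al (i : CyclicQuiver n) : DeformedPreprojective ℂ (CyclicQuiver n) lam :=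
  mk lam (darrow ℂ (V := CyclicQuiver n) (i := i) (j := i + 1) (PLift.up rfl))

/-- The arrow from `i + 1` to `i`. -/
noncomputable def be (i : CyclicQuiver n) : DeformedPreprojective ℂ (CyclicQuiver n) lam :=
  mk lam (dstar ℂ (V := CyclicQuiver n) (i := i) (j := i + 1) (PLift.up rfl))

theorem E_al (i : CyclicQuiver n) : E lam (i + 1) * al lam i = al lam i := by
  unfold E al DeformedPreprojective.e
  rw [← map_mul]; congr 1; exact e_mul_arrow ..

theorem al_E (i : CyclicQuiver n) : al lam i * E lam i = al lam i := by
  unfold E al DeformedPreprojective.e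
  rw [← map_mul]; congr 1; exact arrow_mul_e ..

theorem E_be (i : CyclicQuiver n) : E lam i * be lam i = be lam i := by
  unfold E be DeformedPreprojective.e
  rw [← map_mul]; congr 1; exact e_mul_arrow ..

theorem be_E (i : CyclicQuiver n) : be lam i * E lam (i + 1) = be lam i := by
  unfold E be DeformedPreprojective.e
  rw [← map_mul]; congr 1; exact arrow_mul_e ..

theorem E_E {i j : CyclicQuiver n} (h : i ≠ j) : E lam i * E lam j = 0 := by
  unfold E DeformedPreprojective.e
  rw [← map_mul]
  have := e_mul_e ℂ (V := Quiver.Symmetrify (CyclicQuiver n)) (i := i) (j := j) h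
  unfold de
  rw [this, map_zero]

theorem E_self (i : CyclicQuiver n) : E lam i * E lam i = E lam i :=
  DeformedPreprojective.isIdempotentElem_e (V := CyclicQuiver n) lam i

theorem sum_E : ∑ i, E lam i = 1 := by
  have := sum_e ℂ (V := Quiver.Symmetrify (CyclicQuiver n))
  rw [← map_one (mk (V := CyclicQuiver n) lam), ← this, map_sum]
  rfl

theorem sum_out (n : ℕ) {M : Type} [AddCommMonoid M] (i : CyclicQuiver n)
    (f : ∀ j : CyclicQuiver n, (i ⟶ j) → M) :
    ∑ j : CyclicQuiver n, ∑ a : i ⟶ j, f j a =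
      f (i + 1) (PLift.up rfl) := by
  rw [Finset.sum_eq_single (i + 1)]
  · exact Fintype.sum_eq_single _ fun x hx => absurd (Subsingleton.elim (α := PLift (_ = _ + 1)) x _) hx
  · intro j _ hj
    exact Finset.sum_eq_zero fun x _ => absurd (PLift.down (α := j = (i : CyclicQuiver n) + 1) x) hj
  · intro h; exact absurd (Finset.mem_univ _) h

theorem sum_in (n : ℕ) {M : Type} [AddCommMonoid M] (i : CyclicQuiver n)
    (f : ∀ j : CyclicQuiver n, (j ⟶ i + 1) → M) :
    ∑ j : CyclicQuiver n, ∑ a : j ⟶ i + 1, f j a =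
      f i (PLift.up rfl) := by
  rw [Finset.sum_eq_single i]
  · exact Fintype.sum_eq_single _ fun x hx => absurd (Subsingleton.elim (α := PLift (_ = _ + 1)) x _) hx
  · intro j _ hj
    exact Finset.sum_eq_zero fun x _ => absurd (add_right_cancel (PLift.down (α := i + 1 = j + 1) x)).symm hj
  · intro h; exact absurd (Finset.mem_univ _) h

theorem relation (i : CyclicQuiver n) :
    be lam (i + 1) * al lam (i + 1) - al lam i * be lam i + lam (i + 1) • E lam (i + 1) = 0 := by
  have h := RingQuot.mkAlgHom_rel ℂ
    (PreprojectiveRel.vertex (k := ℂ) (V := CyclicQuiver n) (lam := lam) (i + 1))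
  rw [map_zero] at h
  rw [sum_out n (i + 1) (fun j a => dstar ℂ a * darrow ℂ a),
    sum_in n i (fun j a => darrow ℂ a * dstar ℂ a)] at h
  rw [map_add, map_sub, map_mul, map_mul, map_smul] at h
  exact h

theorem al_be {i j : CyclicQuiver n} (h : i ≠ j) : al lam i * be lam j = 0 := by
  rw [← al_E, ← E_be, mul_assoc, ← mul_assoc (E lam i), E_E lam h, zero_mul, mul_zero]

theorem be_al {i j : CyclicQuiver n} (h : i ≠ j) : be lam i * al lam j = 0 := by
  rw [← be_E, ← E_al, mul_assoc, ← mul_assoc (E lam (i + 1)),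
    E_E lam (fun h' => h (add_right_cancel h')), zero_mul, mul_zero]

theorem adjoin_generators (k : Type) [Field k] (V : Type) [Fintype V] [Quiver.{0} V] :
    Algebra.adjoin k (Set.range (PathAlgebra.e k (V := V)) ∪
      {x | ∃ (i j : V) (a : i ⟶ j), x = PathAlgebra.arrow k a}) = ⊤ := by
  have h := congrArg (Subalgebra.map (RingQuot.mkAlgHom k (PathRel k V)))
    (FreeAlgebra.adjoin_range_ι (R := k) (X := PathGen V))
  rw [AlgHom.map_adjoin, Algebra.map_top,
    (AlgHom.range_eq_top _).mpr (RingQuot.mkAlgHom_surjective k _)] at h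
  refine top_le_iff.mp (h.symm.le.trans (Algebra.adjoin_mono ?_))
  rintro _ ⟨_, ⟨g, rfl⟩, rfl⟩
  cases g with
  | idem i => exact Or.inl ⟨i, rfl⟩
  | arrow a => exact Or.inr ⟨_, _, a, rfl⟩

theorem sum_al_mul (i : CyclicQuiver n) :
    (∑ j, al lam j) * E lam i = E lam (i + 1) * ∑ j, al lam j := by
  rw [Finset.sum_mul, Finset.mul_sum, Finset.sum_eq_single i, Finset.sum_eq_single i]
  · rw [al_E, E_al]
  · intro j _ hj
    rw [← E_al, ← mul_assoc, E_E lam (fun h => hj (add_right_cancel h).symm), zero_mul]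
  · simp
  · intro j _ hj
    rw [← al_E, mul_assoc, E_E lam hj, mul_zero]
  · simp

theorem mul_sum_be (i : CyclicQuiver n) :
    E lam i * (∑ j, be lam j) = (∑ j, be lam j) * E lam (i + 1) := by
  rw [Finset.sum_mul, Finset.mul_sum, Finset.sum_eq_single i, Finset.sum_eq_single i]
  · rw [be_E, E_be]
  · intro j _ hj
    rw [← be_E, mul_assoc, E_E lam (fun h => hj (add_right_cancel h)), mul_zero]
  · simp
  · intro j _ hj
    rw [← E_be, ← mul_assoc, E_E lam hj.symm, zero_mul]
  · simp

theorem sum_comm :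
    (∑ i, al lam i) * (∑ i, be lam i) =
      (∑ i, be lam i) * (∑ i, al lam i) + ∑ i, lam i • E lam i := by
  have h1 : (∑ i, al lam i) * ∑ i, be lam i = ∑ i, al lam i * be lam i := by
    rw [Finset.sum_mul]
    refine Finset.sum_congr rfl fun i _ => ?_
    rw [Finset.mul_sum, Finset.sum_eq_single i]
    · intro j _ hj; exact al_be lam hj.symm
    · simp
  have h2 : (∑ i, be lam i) * ∑ i, al lam i = ∑ i, be lam i * al lam i := by
    rw [Finset.sum_mul]
    refine Finset.sum_congr rfl fun i _ => ?_
    rw [Finset.mul_sum, Finset.sum_eq_single i]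
    · intro j _ hj; exact be_al lam hj.symm
    · simp
  have h3 := Finset.sum_congr (s₁ := (Finset.univ : Finset (CyclicQuiver n))) rfl
    fun i _ => relation lam i
  rw [Finset.sum_add_distrib, Finset.sum_sub_distrib, Finset.sum_const_zero] at h3
  have h4 := Equiv.sum_comp (Equiv.addRight (1 : CyclicQuiver n)) (fun i => be lam i * al lam i)
  have h5 := Equiv.sum_comp (Equiv.addRight (1 : CyclicQuiver n)) (fun i => lam i • E lam i)
  simp only [Equiv.coe_addRight] at h4 h5
  rw [h4, h5] at h3
  rw [h1, h2, ← sub_eq_zero, ← neg_eq_zero, ← h3]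
  abel

theorem adjoin_eq_top :
    Algebra.adjoin ℂ (insert (∑ i, al lam i) (insert (∑ i, be lam i) (Set.range (E lam)))) = ⊤ := by
  set S := Algebra.adjoin ℂ (insert (∑ i, al lam i) (insert (∑ i, be lam i)
    (Set.range (E lam)))) with hS
  have hE : ∀ i, E lam i ∈ S := fun i => Algebra.subset_adjoin (by simp)
  have ha : ∀ i, al lam i ∈ S := fun i => by
    have : al lam i = (∑ j, al lam j) * E lam i := by
      rw [Finset.sum_mul, Finset.sum_eq_single i, al_E]
      · intro j _ hj; rw [← al_E, mul_assoc, E_E lam hj, mul_zero]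
      · simp
    rw [this]; exact S.mul_mem (Algebra.subset_adjoin (by simp)) (hE i)
  have hb : ∀ i, be lam i ∈ S := fun i => by
    have : be lam i = E lam i * ∑ j, be lam j := by
      rw [Finset.mul_sum, Finset.sum_eq_single i, E_be]
      · intro j _ hj; rw [← E_be, ← mul_assoc, E_E lam hj.symm, zero_mul]
      · simp
    rw [this]; exact S.mul_mem (hE i) (Algebra.subset_adjoin (by simp))
  have h := congrArg (Subalgebra.map (mk (V := CyclicQuiver n) lam))
    (adjoin_generators ℂ (Quiver.Symmetrify (CyclicQuiver n)))
  rw [AlgHom.map_adjoin, Algebra.map_top,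
    (AlgHom.range_eq_top (mk (V := CyclicQuiver n) lam)).mpr
    (show Function.Surjective (mk (V := CyclicQuiver n) lam) from
      RingQuot.mkAlgHom_surjective ℂ _)] at h
  refine top_le_iff.mp (h.symm.le.trans (Algebra.adjoin_le ?_))
  rintro _ ⟨_, (⟨i, rfl⟩ | ⟨i, j, a, rfl⟩), rfl⟩
  · exact hE i
  · rcases a with ⟨⟨rfl⟩⟩ | ⟨⟨rfl⟩⟩
    · exact ha i
    · exact hb j


theorem cyclicTriple :
    CyclicTriple (n := n) lam (E lam) (∑ i, al lam i) (∑ i, be lam i) where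
  idem := E_self lam
  orth _ _ h := E_E lam h
  sum_idem := sum_E lam
  a_mul := sum_al_mul lam
  mul_b := mul_sum_be lam
  comm := sum_comm lam
  adjoin := adjoin_eq_top lam

theorem isNoetherianRing_op (hlam : ∑ i, lam i = 0) :
    IsNoetherianRing (DeformedPreprojective ℂ (CyclicQuiver n) lam)ᵐᵒᵖ :=
  (cyclicTriple lam).opposite.isNoetherianRing hlam


/-- A tuple of parameters `lam 0, …, lam n`, as a function on the vertices of the cyclic quiver. -/
def weight (lam : Fin (n + 1) → ℂ) : CyclicQuiver n → ℂ := lam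

end CyclicQuiver

/-- The deformed preprojective algebra `Π^lam(Ã_n)` over `ℂ`; the entry `lam i` is the parameter of
the vertex `i`, where the vertices are numbered `0, …, n`. -/
abbrev PiA (n : ℕ) (lam : Fin (n + 1) → ℂ) : Type :=
  DeformedPreprojective ℂ (CyclicQuiver n) (CyclicQuiver.weight lam)

namespace PiA

variable {n : ℕ} (lam : Fin (n + 1) → ℂ)

/-- The idempotent of the vertex `i`. -/
noncomputable def e (i : Fin (n + 1)) : PiA n lam :=
  DeformedPreprojective.e (V := CyclicQuiver n) (CyclicQuiver.weight lam) i

theorem isIdempotentElem_e (i : Fin (n + 1)) : IsIdempotentElem (e lam i) :=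
  DeformedPreprojective.isIdempotentElem_e (V := CyclicQuiver n) (CyclicQuiver.weight lam) i

theorem isNoetherianRing_op (hlam : ∑ i, lam i = 0) : IsNoetherianRing (PiA n lam)ᵐᵒᵖ :=
  CyclicQuiver.isNoetherianRing_op (n := n) (CyclicQuiver.weight lam) hlam

end PiA

/-! ## Coherent sheaves on the spectrum of a Noetherian ring -/

namespace AlgebraicGeometry
open Scheme.Modules Limits TopologicalSpace

noncomputable section

/-- The localization map `R ⟶ R[1/a]`. -/
abbrev awayHom (R : CommRingCat.{0}) (a : R) :
    R ⟶ CommRingCat.of (Localization.Away a) :=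
  CommRingCat.ofHom (algebraMap R (Localization.Away a))

/-- The inclusion of a basic open subset. -/
abbrev awayMap (R : CommRingCat.{0}) (a : R) :
    Spec (CommRingCat.of (Localization.Away a)) ⟶ Spec R := Spec.map (awayHom R a)

theorem exists_generatingSections_away {R : CommRingCat.{0}} (M : (Spec R).Modules)
    (hM : SheafOfModules.IsFiniteType M) (x : Spec R) :
    ∃ (a : R) (_ : x ∈ (PrimeSpectrum.basicOpen a : (Spec R).Opens))
      (σ : SheafOfModules.GeneratingSections
        (M.restrict (awayMap R a))),
      σ.IsFiniteType := by
  obtain ⟨⟨I, W, cov, gens⟩, hσ⟩ := hM.exists_localGeneratorsData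
  rw [Opens.coversTop_iff, IsOpenCover] at cov
  have hx : x ∈ (⊤ : (Spec R).Opens) := trivial
  rw [← cov, Opens.mem_iSup] at hx
  obtain ⟨i, hi⟩ := hx
  obtain ⟨_, ⟨_, ⟨a, rfl⟩, rfl⟩, hxa, hle⟩ :=
    PrimeSpectrum.isBasis_basic_opens.exists_subset_of_mem_open hi (W i).2
  refine ⟨a, hxa, ?_⟩
  let j : Spec (CommRingCat.of (Localization.Away a)) ⟶ Spec R :=
    awayMap R a
  let V : (Spec R).Opens := W i
  have hj : IsOpenImmersion j := inferInstance
  obtain ⟨u, huj⟩ : ∃ u : Spec (CommRingCat.of (Localization.Away a)) ⟶ V.toScheme,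
      u ≫ V.ι = j := by
    have hr : Set.range j ⊆ Set.range V.ι := by
      rw [Scheme.Opens.range_ι]
      exact (PrimeSpectrum.localization_away_comap_range (Localization.Away a) a).le.trans hle
    exact ⟨IsOpenImmersion.lift V.ι j hr, IsOpenImmersion.lift_fac _ _ _⟩
  have hu : IsOpenImmersion u := by
    have : IsOpenImmersion (u ≫ V.ι) := huj ▸ hj
    exact IsOpenImmersion.of_comp u V.ι
  have : PreservesColimitsOfSize.{0, 0} (restrictFunctor u) := inferInstance
  let F : SheafOfModules ((Spec R).ringCatSheaf.over V) ⥤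
      SheafOfModules (Spec (CommRingCat.of (Localization.Away a))).ringCatSheaf :=
    (overEquiv V).functor ⋙ restrictFunctor u
  let iso : SheafOfModules.overFunctor (Spec R).ringCatSheaf _ ⋙ F ≅ restrictFunctor j :=
    (Functor.associator _ _ _).symm ≪≫
      Functor.isoWhiskerRight (Scheme.Modules.overFunctorEquiv _) _ ≪≫
      (restrictFunctorComp _ _).symm ≪≫
        (restrictFunctorCongr huj)
  have hfin : (gens i).IsFiniteType := hσ.isFiniteType i
  have hV : PreservesColimitsOfSize.{0, 0} (overEquiv V).functor := inferInstance
  have hF : PreservesColimitsOfSize.{0, 0} F :=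
    Limits.comp_preservesColimits (overEquiv V).functor (restrictFunctor u)
  let η : SheafOfModules.unit (Spec (CommRingCat.of (Localization.Away a))).ringCatSheaf ≅
      F.obj (SheafOfModules.unit _) := (Scheme.Modules.restrictUnitIso _).symm
  let φ : F.obj (SheafOfModules.over M V) ⟶ (restrictFunctor j).obj M := iso.hom.app M
  have hφ0 : IsIso φ := (iso.app M).isIso_hom
  have hφ : Epi φ := IsIso.epi_of_iso φ
  exact ⟨SheafOfModules.GeneratingSections.ofEpi ((gens i).map F η) φ,
    ⟨hfin.finite⟩⟩

theorem finite_of_generatingSections {S : CommRingCat.{0}} (N : ModuleCat S)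
    (σ : SheafOfModules.GeneratingSections (tilde N)) (hσ : σ.IsFiniteType) :
    Module.Finite S N := by
  let E : tilde (ModuleCat.of S (σ.I →₀ S)) ≅ SheafOfModules.free σ.I := tildeFinsupp σ.I
  let q : (SheafOfModules.free σ.I : (Spec S).Modules) ⟶ tilde N := σ.π
  have h1 : Epi q := σ.epi
  have h0 : IsIso E.hom := E.isIso_hom
  have h2 : Epi E.hom := IsIso.epi_of_iso E.hom
  have hp : Epi (E.hom ≫ q) := @epi_comp _ _ _ _ _ E.hom h2 q h1
  obtain ⟨f, hf⟩ := (tilde.functor S).map_surjective (E.hom ≫ q)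
  have : Epi f := (tilde.functor S).epi_of_epi_map (by rw [hf]; exact hp)
  have := hσ.finite
  exact Module.Finite.of_surjective f.hom ((ModuleCat.epi_iff_surjective f).mp inferInstance)

theorem exists_linear_restrict_aux {R S : CommRingCat.{0}} (M : (Spec R).Modules) (f : R ⟶ S)
    [IsOpenImmersion (Spec.map f)] (D : (Spec R).Opens) (hD : Spec.map f ''ᵁ ⊤ = D) :
    ∃ e : Γ(M.restrict (Spec.map f), ⊤) ≃+ Γ(M, D), ∀ (r : R) x, e (f r • x) = r • e x := by
  subst hD
  refine ⟨(M.restrictAppIso (Spec.map f) ⊤).addCommGroupIsoToAddEquiv, fun r x => ?_⟩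
  exact Scheme.Modules.restrictAppIso_smul_Spec f (M := M) (U := ⊤) r x

/-- Sections over a basic open set, as global sections of the restriction. -/
theorem exists_linear_restrict {R : CommRingCat.{0}} (M : (Spec R).Modules) (g : R) :
    ∃ e : ((modulesSpecToSheaf.obj M).obj.obj (.op (PrimeSpectrum.basicOpen g))) ≃+
        ((moduleSpecΓFunctor (R := CommRingCat.of (Localization.Away g))).obj
          (M.restrict (awayMap R g))),
      ∀ (r : R) x, e (r • x) = awayHom R g r • e x := by
  obtain ⟨e, he⟩ := exists_linear_restrict_aux M (awayHom R g) (PrimeSpectrum.basicOpen g) (by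
    rw [Scheme.Hom.image_top_eq_opensRange]
    exact Opens.ext (PrimeSpectrum.localization_away_comap_range (Localization.Away g) g))
  refine ⟨e.symm, fun r x => ?_⟩
  refine (AddEquiv.symm_apply_eq e).mpr ?_
  exact ((he r (e.symm x)).trans (congrArg _ (e.apply_symm_apply x))).symm

theorem finite_of_away {R N : Type} [CommRing R] [AddCommGroup N] [Module R N] (T : Set R)
    (hT : Ideal.span T = ⊤)
    (h : ∀ g ∈ T, ∃ (D : Type) (_ : AddCommGroup D) (_ : Module R D) (ρ : N →ₗ[R] D)
      (P : Type) (_ : AddCommGroup P) (_ : Module (Localization.Away g) P) (e : D ≃+ P),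
      IsLocalizedModule.Away g ρ ∧ Module.Finite (Localization.Away g) P ∧
      ∀ (r : R) x, e (r • x) = algebraMap R (Localization.Away g) r • e x) :
    Module.Finite R N := by
  choose D hD1 hD2 ρ P hP1 hP2 e hρ hfin he using fun g : T => h g.1 g.2
  let _ (g : T) : Module R (P g) := Module.compHom _ (algebraMap R (Localization.Away g.1))
  have (g : T) : IsScalarTower R (Localization.Away g.1) (P g) :=
    .of_algebraMap_smul fun _ _ => rfl
  let e' (g : T) : D g ≃ₗ[R] P g := { e g with map_smul' := he g }
  have (g : T) : IsLocalizedModule.Away g.1 ((e' g).toLinearMap ∘ₗ ρ g) :=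
    have := hρ g
    IsLocalizedModule.of_linearEquiv _ _ _
  exact Module.Finite.of_localizationSpan' T hT (Rₚ := fun g => Localization.Away g.1)
    (fun g => (e' g).toLinearMap ∘ₗ ρ g) hfin

theorem finite_of_away' {R : CommRingCat.{0}} (N : ModuleCat.{0} R) (T : Set R)
    (hT : Ideal.span T = ⊤)
    (h : ∀ g ∈ T, ∃ (D : ModuleCat.{0} R) (ρ : N ⟶ D)
      (P : ModuleCat.{0} (CommRingCat.of (Localization.Away g))) (e : D ≃+ P),
      IsLocalizedModule (.powers g) ρ.hom ∧ Module.Finite (CommRingCat.of (Localization.Away g)) P ∧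
      ∀ (r : R) x, e (r • x) = awayHom R g r • e x) :
    Module.Finite R N := by
  refine finite_of_away T hT fun g hg => ?_
  obtain ⟨D, ρ, P, e, h1, h2, h3⟩ := h g hg
  exact ⟨D, _, _, ρ.hom, P, _, inferInstanceAs (Module (CommRingCat.of (Localization.Away g)) P),
    e, h1, h2, h3⟩

theorem finite_of_generatingSections' {S : CommRingCat.{0}} (M : (Spec S).Modules)
    (hQ : SheafOfModules.IsQuasicoherent M)
    (σ : SheafOfModules.GeneratingSections M) (hσ : σ.IsFiniteType) :
    Module.Finite S (moduleSpecΓFunctor.obj M) := by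
  have ht : IsIso (fromTildeΓ M) := Scheme.Modules.isIso_fromTildeΓ_of_isQuasicoherent M
  let t := asIso (fromTildeΓ M)
  exact finite_of_generatingSections _ (SheafOfModules.GeneratingSections.equivOfIso t.symm σ)
    ⟨hσ.finite⟩

theorem finite_top_of_isFiniteType {R : CommRingCat.{0}} (M : (Spec R).Modules)
    (hQ : SheafOfModules.IsQuasicoherent M) (hM : SheafOfModules.IsFiniteType M) :
    Module.Finite R (moduleSpecΓFunctor.obj M) := by
  choose a hxa σ hσ using exists_generatingSections_away M hM
  have hloc := (isIso_fromTildeΓ_iff_isLocalizing M).mp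
    (Scheme.Modules.isIso_fromTildeΓ_of_isQuasicoherent M)
  refine finite_of_away' _ (Set.range a) ?_ ?_
  · rw [← PrimeSpectrum.iSup_basicOpen_eq_top_iff]
    refine top_le_iff.mp fun x _ => ?_
    have : x ∈ (PrimeSpectrum.basicOpen (a x) : Opens (PrimeSpectrum R)) := hxa x
    exact (le_iSup (fun y => (PrimeSpectrum.basicOpen (a y) : Opens (PrimeSpectrum R))) x) this
  · rintro _ ⟨x, rfl⟩
    obtain ⟨e, he⟩ := exists_linear_restrict M (a x)
    let D : (Spec R).Opens := PrimeSpectrum.basicOpen (a x)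
    refine ⟨(modulesSpecToSheaf.obj M).obj.obj (.op D),
      (modulesSpecToSheaf.obj M).obj.map (Opens.leTop D).op,
      (moduleSpecΓFunctor (R := CommRingCat.of (Localization.Away (a x)))).obj
          (M.restrict (awayMap R (a x))), e, ?_, ?_, ?_⟩
    · exact hloc (a x)
    · exact finite_of_generatingSections' (M.restrict (awayMap R (a x)))
        (Scheme.Modules.isQuasicoherent_restrictFunctor (awayMap R (a x)) M) (σ x) (hσ x)
    · exact he

theorem isFiniteType_tilde {R : CommRingCat.{0}} (N : ModuleCat R) [Module.Finite R N] :
    SheafOfModules.IsFiniteType (tilde N) := by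
  obtain ⟨m, f, hf⟩ := Module.Finite.exists_fin' R N
  have : Epi (ModuleCat.ofHom f) := (ModuleCat.epi_iff_surjective _).mpr hf
  let g : ModuleCat.of R (Fin m →₀ R) ⟶ N :=
    ModuleCat.ofHom (f ∘ₗ (Finsupp.linearEquivFunOnFinite R R (Fin m)).toLinearMap)
  have hg : Epi g := (ModuleCat.epi_iff_surjective _).mpr
    (hf.comp (Finsupp.linearEquivFunOnFinite R R (Fin m)).surjective)
  have hg' : Epi ((tilde.functor R).map g) := inferInstance
  let E : tilde (ModuleCat.of R (Fin m →₀ R)) ≅ SheafOfModules.free (Fin m) := tildeFinsupp (Fin m)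
  have h0 : IsIso E.inv := E.isIso_inv
  have h2 : Epi E.inv := IsIso.epi_of_iso E.inv
  let p : SheafOfModules.free (R := (Spec R).ringCatSheaf) (Fin m) ⟶ tilde N :=
    E.inv ≫ (tilde.functor R).map g
  have hp : Epi p := @epi_comp _ _ _ _ _ E.inv h2 ((tilde.functor R).map g) hg'
  let σ : SheafOfModules.GeneratingSections (tilde N) :=
    { I := Fin m
      s := SheafOfModules.freeHomEquiv _ p
      epi := by rw [Equiv.symm_apply_apply]; exact hp }
  have hσ : σ.IsFiniteType := ⟨inferInstanceAs (Finite (Fin m))⟩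
  exact ⟨σ.localGeneratorsData, ⟨fun _ => ⟨hσ.finite⟩⟩⟩

end

end AlgebraicGeometry

namespace AlgebraicGeometry
open Scheme.Modules Limits TopologicalSpace

noncomputable section

/-- Coherent sheaves on a (Noetherian) scheme: quasi-coherent sheaves of `𝒪_X`-modules of finite
type. -/
def isCoherent (X : Scheme.{0}) : ObjectProperty X.Modules := fun M =>
  SheafOfModules.IsQuasicoherent M ∧ SheafOfModules.IsFiniteType M

/-- The category `Coh(X)` of coherent sheaves on a (Noetherian) scheme, a full subcategory of the
category of sheaves of `𝒪_X`-modules. -/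
def Coh (X : Scheme.{0}) : Type 1 := (isCoherent X).FullSubcategory

namespace Coh

instance (X : Scheme.{0}) : Category.{0} (Coh X) :=
  inferInstanceAs (Category (isCoherent X).FullSubcategory)

/-- Sums of morphisms are formed in the category of all sheaves of modules. -/
abbrev preadditive (X : Scheme.{0}) : Preadditive (Coh X) :=
  inferInstanceAs (Preadditive (isCoherent X).FullSubcategory)

/-- The inclusion into the category of all sheaves of modules. -/
def incl (X : Scheme.{0}) : Coh X ⥤ X.Modules := (isCoherent X).ι

instance (X : Scheme.{0}) : (incl X).Full := inferInstanceAs (isCoherent X).ι.Full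
instance (X : Scheme.{0}) : (incl X).Faithful := inferInstanceAs (isCoherent X).ι.Faithful

variable (R : CommRingCat.{0})

/-- The coherent sheaf on `Spec R` given by a finitely generated `R`-module. -/
def tilde : FGModuleCat R ⥤ Coh (Spec R) :=
  (isCoherent (Spec R)).lift ((ModuleCat.isFG R).ι ⋙ tilde.functor R)
    fun N => ⟨inferInstanceAs (SheafOfModules.IsQuasicoherent (AlgebraicGeometry.tilde N.obj)),
      isFiniteType_tilde N.obj⟩

/-- The same sheaf, as a sheaf of modules. -/
def tildeIncl : FGModuleCat R ⥤ (Spec R).Modules :=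
  (ModuleCat.isFG R).ι ⋙ AlgebraicGeometry.tilde.functor R

instance : (tildeIncl R).Full :=
  have := (AlgebraicGeometry.tilde.fullyFaithfulFunctor (R := R)).full
  Functor.Full.comp (ModuleCat.isFG R).ι (AlgebraicGeometry.tilde.functor R)
instance : (tildeIncl R).Faithful :=
  have := (AlgebraicGeometry.tilde.fullyFaithfulFunctor (R := R)).faithful
  Functor.Faithful.comp (ModuleCat.isFG R).ι (AlgebraicGeometry.tilde.functor R)
instance : (tildeIncl R).Additive :=
  inferInstanceAs ((ModuleCat.isFG R).ι ⋙ AlgebraicGeometry.tilde.functor R).Additive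

instance : (tilde R).Full :=
  have : (tilde R ⋙ incl (Spec R)).Full := inferInstanceAs (tildeIncl R).Full
  Functor.Full.of_comp_faithful (tilde R) (incl (Spec R))

instance : (tilde R).Faithful :=
  have : (tilde R ⋙ incl (Spec R)).Faithful := inferInstanceAs (tildeIncl R).Faithful
  Functor.Faithful.of_comp (tilde R) (incl (Spec R))

instance : (tilde R).EssSurj where
  mem_essImage M := by
    have hM : isCoherent (Spec R) M.1 := M.2
    have := finite_top_of_isFiniteType M.1 hM.1 hM.2
    have ht : IsIso (fromTildeΓ M.1) :=
      have := hM.1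
      Scheme.Modules.isIso_fromTildeΓ_of_isQuasicoherent M.1
    let i := asIso (fromTildeΓ M.1)
    exact ⟨FGModuleCat.of R (moduleSpecΓFunctor.obj M.1), ⟨ObjectProperty.isoMk _ i⟩⟩

instance : (tilde R).IsEquivalence where

/-- Over a Noetherian ring the category of coherent sheaves on the spectrum is abelian. -/
instance [IsNoetherianRing R] : Abelian (Coh (Spec R)) :=
  letI := preadditive (Spec R)
  have : HasFiniteProducts (Coh (Spec R)) :=
    ⟨fun _ => Adjunction.hasLimitsOfShape_of_equivalence (tilde R).inv⟩
  have : (tilde R).Additive := ⟨fun {_ _ f g} => (incl (Spec R)).map_injective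
    (show (tildeIncl R).map (f + g) = (tildeIncl R).map f + (tildeIncl R).map g from
      (tildeIncl R).map_add)⟩
  have : (tilde R).inv.Additive := @Equivalence.inverse_additive _ _ _ _ _ _ (tilde R).asEquivalence this
  abelianOfEquivalence (tilde R).inv

end Coh
end
end AlgebraicGeometry

/-! ## Bounded derived categories -/

section DerivedEquivalence

attribute [local instance] HasDerivedCategory.standard

/-- `D^b(C)` and `D^b(D)` are equivalent as `k`-linear triangulated categories, for `k`-linear
abelian categories `C` and `D`. -/
def BoundedDerivedEquivalent (k : Type) [Field k]
    (C : Type 1) [Category.{0} C] [Abelian C] [Linear k C]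
    (D : Type 1) [Category.{0} D] [Abelian D] [Linear k D] : Prop :=
  ∃ (F : DerivedCategory.Bounded C ⥤ DerivedCategory.Bounded D) (_ : F.CommShift ℤ),
    F.IsEquivalence ∧ F.IsTriangulated ∧ F.Linear k

end DerivedEquivalence

/-- The `k`-linear structure of a category that admits a fully faithful additive functor to a
`k`-linear category. -/
abbrev linearOfFullyFaithful (k : Type) [Field k]
    {C D : Type*} [Category C] [Preadditive C] [Category D] [Preadditive D] [Linear k D]
    {F : C ⥤ D} [F.Additive] (hF : F.FullyFaithful) : Linear k C where
  homModule X Y :=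
    { smul := fun c f => hF.preimage (c • F.map f)
      one_smul := fun f => hF.map_injective (by
        change F.map (hF.preimage _) = _; rw [hF.map_preimage, one_smul])
      mul_smul := fun c d f => hF.map_injective (by
        change F.map (hF.preimage _) = F.map (hF.preimage (c • F.map (hF.preimage (d • F.map f))))
        rw [hF.map_preimage, hF.map_preimage, hF.map_preimage, mul_smul])
      smul_zero := fun c => hF.map_injective (by
        change F.map (hF.preimage _) = _; rw [hF.map_preimage, F.map_zero, smul_zero])
      smul_add := fun c f g => hF.map_injective (by
        change F.map (hF.preimage (c • F.map (f + g))) =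
          F.map (hF.preimage (c • F.map f) + hF.preimage (c • F.map g))
        rw [F.map_add, hF.map_preimage, F.map_add, hF.map_preimage, hF.map_preimage, smul_add])
      add_smul := fun c d f => hF.map_injective (by
        change F.map (hF.preimage ((c + d) • F.map f)) =
          F.map (hF.preimage (c • F.map f) + hF.preimage (d • F.map f))
        rw [F.map_add, hF.map_preimage, hF.map_preimage, hF.map_preimage, add_smul])
      zero_smul := fun f => hF.map_injective (by
        change F.map (hF.preimage ((0 : k) • F.map f)) = F.map 0
        rw [F.map_zero, hF.map_preimage, zero_smul]) }
  smul_comp X Y Z c f g := hF.map_injective (by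
    change F.map (hF.preimage (c • F.map f) ≫ g) = F.map (hF.preimage (c • F.map (f ≫ g)))
    rw [F.map_comp, hF.map_preimage, hF.map_preimage, F.map_comp, Linear.smul_comp])
  comp_smul X Y Z f c g := hF.map_injective (by
    change F.map (f ≫ hF.preimage (c • F.map g)) = F.map (hF.preimage (c • F.map (f ≫ g)))
    rw [F.map_comp, hF.map_preimage, hF.map_preimage, F.map_comp, Linear.comp_smul])

namespace AlgebraicGeometry.Coh
noncomputable section

variable (A : Type) [CommRing A]

/-- A coherent sheaf on `Spec A`, as a presheaf of `A`-modules. -/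
def toPresheaf : Coh (Spec (.of A)) ⥤ ((Spec (.of A)).Opens)ᵒᵖ ⥤ ModuleCat.{0} A :=
  incl _ ⋙ modulesSpecToSheaf ⋙ sheafToPresheaf _ _

def fullyFaithfulToPresheaf : (toPresheaf A).FullyFaithful :=
  ((isCoherent (Spec (.of A))).fullyFaithfulι.comp SpecModulesToSheafFullyFaithful).comp
    (fullyFaithfulSheafToPresheaf _ _)

instance [IsNoetherianRing A] : (toPresheaf A).Additive where
  map_add := rfl

/-- On the spectrum of a `ℂ`-algebra, `c • f` is given on sections by `x ↦ c • f x`. -/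
instance [IsNoetherianRing A] [Algebra ℂ A] : Linear ℂ (Coh (Spec (.of A))) :=
  linearOfFullyFaithful ℂ (fullyFaithfulToPresheaf A)

end
end AlgebraicGeometry.Coh

/-! ## The affine Milnor fibre -/

section MilnorFibre

open MvPolynomial

/-- The ring `ℂ[X, Y, Z] / (X Y - P(Z))`. -/
abbrev MilnorRing (P : Polynomial ℂ) : Type :=
  MvPolynomial (Fin 3) ℂ ⧸
    Ideal.span {(X 0 * X 1 - Polynomial.aeval (X 2) P : MvPolynomial (Fin 3) ℂ)}

/-- The affine Milnor fibre `{X Y = P(Z)}`, as a scheme. -/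
noncomputable abbrev MilnorFibre (P : Polynomial ℂ) : AlgebraicGeometry.Scheme.{0} :=
  AlgebraicGeometry.Spec (.of (MilnorRing P))

end MilnorFibre

/-! Vertices are numbered from `0`, so the distinguished vertex is `Fin.last n`, and
`CyclicTriple.root lam i` is the partial sum `Λ` that ends at vertex `i`. Write `a` and `b` for the
sums of all arrows and of all opposite arrows, and `ζ = b a + ∑ Λ_i e_i` for `zeta`. Because the
parameters sum to zero, the `Λ_i` are consistent around the cycle, and `ζ` is central. At each
vertex a two-step detour is a linear polynomial in `ζ`: `b a e_i = (ζ - Λ_i) e_i` and `a b e_{i+1} =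
(ζ - Λ_i) e_{i+1}`.

The corner. Iterating these identities once around the cycle gives `a^(n+1) b^(n+1) = ∏ (ζ - Λ_i)`
(`pow_a_mul_pow_b_eq`). With `c` the leading coefficient of `P`, the assignment `X ↦ a^(n+1)`, `Y ↦
c b^(n+1)`, `Z ↦ ζ` is therefore a homomorphism from the Milnor ring to the centre. The same
identities remove every turn of a path, so the algebra is spanned by elements `p(ζ) a^m e_i` and
`p(ζ) b^m e_i` (`mem_span_paths`). Only closed paths survive in the corner, which makes the
homomorphism to the corner surjective. Injectivity comes from a representation by cyclic matrices
over `ℂ[Z][T, T⁻¹]` (`exists_rep`), in which the central elements act as scalars through the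
embedding `X ↦ T`, `Y ↦ P(Z) T⁻¹`, `Z ↦ Z` of the Milnor ring.

Distinct roots. The sums over intervals are differences of the `Λ_i`; those that would end at the
last vertex are replaced by complementary ones, since the total is zero.

Derived equivalence. From vertex `i` the last vertex is reached forwards or backwards. The two round
trips give products of `ζ - Λ_j` over complementary sets of vertices. If the roots are distinct,
these polynomials are coprime, and Bézout puts `e_i` in the ideal generated by the last idempotent
(`exists_E_eq`). That idempotent is then full, so `M ↦ f M` is a Morita equivalence with modules
over the corner, and the derived equivalences already come from equivalences of abelian categories.
Coherent sheaves enter through the equivalence with finitely generated modules on an affine scheme.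
-/

section DerivedEquivalence

open Limits DerivedCategory.TStructure

/-! ### Bounded derived categories under an equivalence of abelian categories -/

namespace CategoryTheory.Functor

variable {C D : Type*} [Category* C] [Category* D] [Abelian C] [Abelian D]
  [HasDerivedCategory C] [HasDerivedCategory D] (F : C ⥤ D) [F.Additive] [F.IsEquivalence]

/-- An equivalence of abelian categories induces an equivalence of cochain complexes. -/
instance isEquivalence_mapHomologicalComplex :
    (F.mapHomologicalComplex (ComplexShape.up ℤ)).IsEquivalence :=
  (F.asEquivalence.mapHomologicalComplex (ComplexShape.up ℤ)).isEquivalence_functor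

/-- An equivalence of categories of complexes descends to the localizations once every
quasi-isomorphism of the target is, up to isomorphism of arrows, the image of one of the source. A
preimage of the arrow exists by fullness and essential surjectivity, and it is a quasi-isomorphism
because `F` is exact and reflects isomorphisms in homology. -/
instance isEquivalence_mapDerivedCategory : F.mapDerivedCategory.IsEquivalence := by
  let Φ := F.mapHomologicalComplexUpToQuasiIsoLocalizerMorphism (ComplexShape.up ℤ)
  have : Φ.functor.IsEquivalence := F.isEquivalence_mapHomologicalComplex
  have : Φ.IsLocalizedEquivalence := by
    refine .of_equivalence Φ fun X Y f hf => ?_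
    let G := F.mapHomologicalComplex (ComplexShape.up ℤ)
    let e : Arrow.mk (G.map (G.preimage ((G.objObjPreimageIso X).hom ≫ f ≫
        (G.objObjPreimageIso Y).inv))) ≅ Arrow.mk f :=
      Arrow.isoMk (G.objObjPreimageIso X) (G.objObjPreimageIso Y) (by simp)
    refine ⟨_, _, G.preimage ((G.objObjPreimageIso X).hom ≫ f ≫ (G.objObjPreimageIso Y).inv),
      ?_, ⟨e⟩⟩
    have h : HomologicalComplex.quasiIso D (.up ℤ) (G.map (G.preimage
      ((G.objObjPreimageIso X).hom ≫ f ≫ (G.objObjPreimageIso Y).inv))) :=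
      ((HomologicalComplex.quasiIso D (.up ℤ)).arrow_mk_iso_iff e).mpr hf
    rw [HomologicalComplex.mem_quasiIso_iff] at h ⊢
    exact (HomologicalComplex.quasiIso_map_iff_of_preservesHomology _ F).mp h
  let _ : CatCommSq Φ.functor DerivedCategory.Q DerivedCategory.Q F.mapDerivedCategory :=
    ⟨F.mapDerivedCategoryFactors.symm⟩
  exact Φ.isEquivalence DerivedCategory.Q DerivedCategory.Q F.mapDerivedCategory

/-- A bounded object is represented by a strictly bounded complex, and the derived functor of an
exact functor is computed termwise on it, within the same bounds. -/
theorem bounded_mapDerivedCategory (F : C ⥤ D) [F.Additive] [PreservesFiniteLimits F]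
    [PreservesFiniteColimits F]
    (X : DerivedCategory C) (hX : t.bounded X) : t.bounded (F.mapDerivedCategory.obj X) := by
  obtain ⟨⟨a, ha⟩, ⟨b, hb⟩⟩ := hX
  obtain ⟨K, _, _, ⟨e⟩⟩ := X.exists_iso_Q_obj_of_isGE_of_isLE a b
  let e' := F.mapDerivedCategory.mapIso e ≪≫ F.mapDerivedCategoryFactors.app K
  have h1 : CochainComplex.IsStrictlyGE ((F.mapHomologicalComplex (ComplexShape.up ℤ)).obj K) a := inferInstance
  have h2 : CochainComplex.IsStrictlyLE ((F.mapHomologicalComplex (ComplexShape.up ℤ)).obj K) b := inferInstance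
  exact ⟨⟨a, ⟨_, e', h1⟩⟩, ⟨b, ⟨_, e', h2⟩⟩⟩

/-- The functor on bounded derived categories induced by an exact functor. -/
noncomputable def mapBounded (F : C ⥤ D) [F.Additive] [PreservesFiniteLimits F]
    [PreservesFiniteColimits F] : DerivedCategory.Bounded C ⥤ DerivedCategory.Bounded D :=
  t.bounded.lift (t.bounded.ι ⋙ F.mapDerivedCategory)
    fun X => F.bounded_mapDerivedCategory X.1 X.2

noncomputable instance (F : C ⥤ D) [F.Additive] [PreservesFiniteLimits F]
    [PreservesFiniteColimits F] : F.mapBounded.CommShift ℤ := by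
  dsimp only [mapBounded]
  infer_instance

instance (F : C ⥤ D) [F.Additive] [PreservesFiniteLimits F]
    [PreservesFiniteColimits F] : F.mapBounded.IsTriangulated := by
  dsimp only [mapBounded]
  infer_instance

instance (R : Type*) [Ring R] [CategoryTheory.Linear R C] [CategoryTheory.Linear R D] [F.Linear R] :
    F.mapBounded.Linear R where
  map_smul f r := t.bounded.ι.map_injective <|
    F.mapDerivedCategory.map_smul r (t.bounded.ι.map f)

instance isEquivalence_mapBounded : F.mapBounded.IsEquivalence where
  faithful := by dsimp only [mapBounded]; infer_instance
  full := by dsimp only [mapBounded]; infer_instance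
  -- The preimage has to be bounded as well, so it is built by applying the inverse functor termwise
  -- to a strictly bounded representative.
  essSurj := by
    refine ⟨fun ⟨Y, ⟨a, ha⟩, ⟨b, hb⟩⟩ => ?_⟩
    obtain ⟨K, _, _, ⟨e⟩⟩ := Y.exists_iso_Q_obj_of_isGE_of_isLE a b
    let G := F.mapHomologicalComplex (ComplexShape.up ℤ)
    let L := (F.inv.mapHomologicalComplex (ComplexShape.up ℤ)).obj K
    have h1 : CochainComplex.IsStrictlyGE L a := inferInstance
    have h2 : CochainComplex.IsStrictlyLE L b := inferInstance
    let e' : F.mapDerivedCategory.obj (DerivedCategory.Q.obj L) ≅ Y :=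
      F.mapDerivedCategoryFactors.app L ≪≫ DerivedCategory.Q.mapIso
        ((F.asEquivalence.mapHomologicalComplex (ComplexShape.up ℤ)).counitIso.app K) ≪≫ e.symm
    exact ⟨⟨DerivedCategory.Q.obj L, ⟨⟨a, ⟨L, Iso.refl _, h1⟩⟩, ⟨b, ⟨L, Iso.refl _, h2⟩⟩⟩⟩,
      ⟨t.bounded.ι.preimageIso e'⟩⟩

end CategoryTheory.Functor

attribute [local instance] HasDerivedCategory.standard

/-- A linear equivalence of abelian categories induces an equivalence of bounded derived
categories. -/
theorem BoundedDerivedEquivalent.of_functor (k : Type) [Field k]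
    {C : Type 1} [Category.{0} C] [Abelian C] [Linear k C]
    {D : Type 1} [Category.{0} D] [Abelian D] [Linear k D]
    (F : C ⥤ D) [F.Additive] [F.Linear k] [F.IsEquivalence] :
    BoundedDerivedEquivalent k C D :=
  ⟨F.mapBounded, inferInstance, inferInstance, inferInstance, inferInstance⟩

end DerivedEquivalence

/-! ## Morita equivalence for a full corner -/

section Corner

variable {k R B : Type} [Field k] [Ring R] [Algebra k R] [Ring B] [Algebra k B]

/-- `φ` identifies `R` with the corner `f B f` of the idempotent `f = φ 1`, and `B f B = B`. -/
structure IsFullCorner (φ : R →ₙₐ[k] B) : Prop where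
  injective : Function.Injective φ
  exists_eq (b : B) : ∃ r, φ r = φ 1 * b * φ 1
  exists_sum : ∃ (ι : Type) (_ : Fintype ι) (x y : ι → B), ∑ i, x i * φ 1 * y i = 1

/-- The part `f M` of a left `B`-module `M`, where `f = φ 1`. -/
def CornerModule (φ : R →ₙₐ[k] B) (M : Type) [AddCommGroup M] [Module B M] : Type :=
  (((Module.toAddMonoidEnd B M) (φ 1) - 1).ker : AddSubgroup M)

namespace CornerModule

variable (φ : R →ₙₐ[k] B) (M : Type) [AddCommGroup M] [Module B M]

instance : AddCommGroup (CornerModule φ M) :=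
  inferInstanceAs (AddCommGroup (((Module.toAddMonoidEnd B M) (φ 1) - 1).ker : AddSubgroup M))

/-- The inclusion `f M → M`. -/
def val : CornerModule φ M →+ M :=
  (((Module.toAddMonoidEnd B M) (φ 1) - 1).ker : AddSubgroup M).subtype

variable {φ M}

theorem val_injective : Function.Injective (val φ M) := Subtype.val_injective

theorem one_smul_val (x : CornerModule φ M) : φ 1 • val φ M x = val φ M x := by
  have h : φ 1 • val φ M x - val φ M x = 0 := x.2
  exact sub_eq_zero.mp h

/-- An element of `M` fixed by `f`, as an element of `f M`. -/
def ofFixed (m : M) (h : φ 1 • m = m) : CornerModule φ M := ⟨m, sub_eq_zero.mpr h⟩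

theorem val_ofFixed (m : M) (h : φ 1 • m = m) : val φ M (ofFixed m h) = m := rfl

theorem one_mul_map (φ : R →ₙₐ[k] B) (r : R) : φ 1 * φ r = φ r := by rw [← map_mul, one_mul]

theorem map_mul_one (φ : R →ₙₐ[k] B) (r : R) : φ r * φ 1 = φ r := by rw [← map_mul, mul_one]

theorem one_smul_map_smul (r : R) (m : M) : φ 1 • φ r • m = φ r • m := by
  rw [smul_smul, one_mul_map]

instance : Module R (CornerModule φ M) where
  smul r x := ofFixed (φ r • val φ M x) (one_smul_map_smul r _)
  one_smul x := val_injective (one_smul_val x)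
  mul_smul r s x := val_injective (by
    change φ (r * s) • val φ M x = φ r • φ s • val φ M x
    rw [map_mul, mul_smul])
  smul_zero r := val_injective (by
    change φ r • val φ M 0 = val φ M 0
    rw [map_zero, smul_zero])
  smul_add r x y := val_injective (by
    change φ r • val φ M (x + y) = φ r • val φ M x + φ r • val φ M y
    rw [map_add, smul_add])
  add_smul r s x := val_injective (by
    change φ (r + s) • val φ M x = φ r • val φ M x + φ s • val φ M x
    rw [map_add, add_smul])
  zero_smul x := val_injective (by
    change φ 0 • val φ M x = val φ M 0
    rw [map_zero, zero_smul, map_zero])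

theorem val_smul (r : R) (x : CornerModule φ M) : val φ M (r • x) = φ r • val φ M x := rfl

/-- Since `φ` is not unital, a scalar `c` of `R` goes to `c f` rather than to `c`; the two agree on
`f M`. This is what makes `M ↦ f M` a `k`-linear functor. -/
theorem algebraMap_smul_val (c : k) (x : CornerModule φ M) :
    algebraMap k B c • val φ M x = φ (algebraMap k R c) • val φ M x := by
  have h : φ (algebraMap k R c) = algebraMap k B c * φ 1 := by
    rw [Algebra.algebraMap_eq_smul_one, map_smul, Algebra.smul_def]
  rw [h, mul_smul, one_smul_val]

variable (φ) in
/-- The projection of `M` to `f M`. -/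
def proj : M →+ CornerModule φ M where
  toFun m := ofFixed (φ 1 • m) (one_smul_map_smul 1 m)
  map_zero' := val_injective (smul_zero (φ 1))
  map_add' x y := val_injective (smul_add (φ 1) x y)

theorem val_proj (m : M) : val φ M (proj φ m) = φ 1 • m := rfl

variable {N : Type} [AddCommGroup N] [Module B N]

variable (φ) in
/-- The map on corner modules induced by a linear map. -/
def map (g : M →ₗ[B] N) : CornerModule φ M →ₗ[R] CornerModule φ N where
  toFun x := ofFixed (g (val φ M x)) (by rw [← map_smul, one_smul_val])
  map_add' x y := val_injective (by
    change g (val φ M (x + y)) = g (val φ M x) + g (val φ M y)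
    rw [map_add, map_add])
  map_smul' r x := val_injective (by
    change g (φ r • val φ M x) = φ r • g (val φ M x)
    rw [map_smul])

end CornerModule

/-! ### Full faithfulness of `M ↦ f M` and finite generation -/

namespace IsFullCorner

open CornerModule

variable {φ : R →ₙₐ[k] B} (hφ : IsFullCorner φ)
  {M : Type} [AddCommGroup M] [Module B M] {N : Type} [AddCommGroup N] [Module B N]

include hφ

/-- Fullness gives `v = ∑ x_i f y_i v`, so `M` is generated by `f M` and a linear map is determined
there. -/
theorem map_injective {g h : M →ₗ[B] N} (H : CornerModule.map φ g = CornerModule.map φ h) :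
    g = h := by
  obtain ⟨ι, _, x, y, hxy⟩ := hφ.exists_sum
  ext v
  have key (z : B) : g (φ 1 • z • v) = h (φ 1 • z • v) :=
    congrArg (val φ N) (LinearMap.congr_fun H (proj φ (z • v)))
  rw [← one_smul B v, ← hxy, Finset.sum_smul, map_sum, map_sum]
  refine Finset.sum_congr rfl fun i _ => ?_
  rw [mul_assoc, mul_smul, mul_smul, map_smul, map_smul h, key]

/-- The only possible extension of `h` is `g v = ∑ x_i h(f y_i v)`. It is `B`-linear because `h`
commutes with `f B f = φ(R)`, as one sees by inserting `1 = ∑ x_i f y_i` on both sides of `b`. -/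
theorem map_surjective (h : CornerModule φ M →ₗ[R] CornerModule φ N) :
    ∃ g : M →ₗ[B] N, CornerModule.map φ g = h := by
  obtain ⟨ι, _, x, y, hxy⟩ := hφ.exists_sum
  -- On `f M` the operator `f b` equals `f b f`, which is some `φ r`, so `R`-linearity of `h`
  -- applies.
  have hsmul (b : B) (v : CornerModule φ M) :
      φ 1 • b • val φ N (h v) = val φ N (h (proj φ (b • val φ M v))) := by
    obtain ⟨r, hr⟩ := hφ.exists_eq b
    have h1 : proj φ (b • val φ M v) = r • v := val_injective (by
      rw [val_proj, val_smul, hr, mul_smul, mul_smul, one_smul_val])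
    rw [h1, map_smul, val_smul, hr, mul_smul, mul_smul, one_smul_val]
  let g : M →+ N :=
    { toFun := fun v => ∑ i, x i • val φ N (h (proj φ (y i • v)))
      map_zero' := by simp
      map_add' := fun v w => by simp [smul_add, Finset.sum_add_distrib] }
  have hg (v : M) : g v = ∑ i, x i • val φ N (h (proj φ (y i • v))) := rfl
  refine ⟨{ g with map_smul' := fun b v => ?_ }, ?_⟩
  · change g (b • v) = b • g v
    -- Insert the resolution of `1` between `b` and `v`: `f y_j b v = ∑_i f (y_j b x_i) f y_i v`.
    have h1 (j : ι) : proj φ (y j • b • v) =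
        ∑ i, proj φ ((y j * b * x i) • val φ M (proj φ (y i • v))) := by
      rw [← map_sum]
      congr 1
      simp only [val_proj, smul_smul]
      rw [← Finset.sum_smul]
      have h2 : ∑ i, y j * b * x i * φ 1 * y i = y j * b := by
        conv_rhs => rw [← mul_one (y j * b), ← hxy, Finset.mul_sum]
        simp only [mul_assoc]
      simp only [← mul_assoc]
      rw [h2]
    -- Insert the resolution of `1` to the left of `b`; the two double sums then agree term by term
    -- by `hsmul`.
    have h2 : b • g v = ∑ i, ∑ j, x j • φ 1 • (y j * b * x i) • val φ N (h (proj φ (y i • v))) := by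
      rw [hg, Finset.smul_sum]
      refine Finset.sum_congr rfl fun i _ => ?_
      simp only [smul_smul]
      rw [← Finset.sum_smul]
      simp only [← mul_assoc]
      simp only [mul_assoc _ b]
      rw [← Finset.sum_mul, hxy, one_mul]
    rw [h2, Finset.sum_comm, hg]
    refine Finset.sum_congr rfl fun j _ => ?_
    rw [h1, map_sum, map_sum, Finset.smul_sum]
    exact Finset.sum_congr rfl fun i _ => by rw [hsmul]
  · ext v
    refine val_injective ?_
    change g (val φ M v) = val φ N (h v)
    rw [hg]
    simp only [← hsmul]
    simp only [smul_smul]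
    rw [← Finset.sum_smul]
    simp only [← mul_assoc]
    rw [hxy, one_smul]

/-- If the `v` generate `M`, the elements `f y_i v` generate `f M`, because `f b v = ∑ (f b x_i f)
(f y_i v)` and the coefficients lie in `φ(R)`. -/
theorem finite_cornerModule [Module.Finite B M] : Module.Finite R (CornerModule φ M) := by
  classical
  obtain ⟨ι, _, x, y, hxy⟩ := hφ.exists_sum
  obtain ⟨s, hs⟩ := Module.Finite.fg_top (R := B) (M := M)
  let T : Finset (CornerModule φ M) :=
    Finset.image₂ (fun v i => proj φ (y i • v)) s Finset.univ
  refine ⟨⟨T, top_le_iff.mp fun w _ => ?_⟩⟩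
  -- The quantifier over `b` stays inside the induction, so that scalars from `B` are absorbed into
  -- `b`.
  have key (v : M) : ∀ b : B, proj φ (b • v) ∈ Submodule.span R (T : Set (CornerModule φ M)) := by
    have hv : v ∈ Submodule.span B (s : Set M) := hs ▸ trivial
    induction hv using Submodule.span_induction with
    | zero => intro b; simp
    | add v w _ _ hv hw => intro b; rw [smul_add, map_add]; exact add_mem (hv b) (hw b)
    | smul a v _ hv => intro b; rw [smul_smul]; exact hv _
    | mem v hv =>
      intro b
      choose r hr using fun i => hφ.exists_eq (b * x i)
      have h1 : proj φ (b • v) = ∑ i, r i • proj φ (y i • v) := val_injective (by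
        rw [map_sum]
        simp only [val_smul, val_proj, hr, smul_smul]
        rw [← Finset.sum_smul]
        congr 1
        conv_lhs => rw [← mul_one b, ← hxy, Finset.mul_sum, Finset.mul_sum]
        refine Finset.sum_congr rfl fun i _ => ?_
        have h2 : φ 1 * φ 1 = φ 1 := one_mul_map φ 1
        simp only [mul_assoc]
        rw [← mul_assoc (φ 1) (φ 1) (y i), h2])
      rw [h1]
      exact Submodule.sum_mem _ fun i _ => Submodule.smul_mem _ _
        (Submodule.subset_span (Finset.mem_image₂_of_mem hv (Finset.mem_univ i)))
  have h3 : w = proj φ ((1 : B) • val φ M w) := val_injective (by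
    rw [val_proj, one_smul, one_smul_val])
  rw [h3]
  exact key _ 1

/-- Generators of `f M` over `R` generate `M` over `B`, since `M = B f M`. -/
theorem finite_of_cornerModule [Module.Finite R (CornerModule φ M)] : Module.Finite B M := by
  classical
  obtain ⟨ι, _, x, y, hxy⟩ := hφ.exists_sum
  obtain ⟨s, hs⟩ := Module.Finite.fg_top (R := R) (M := CornerModule φ M)
  refine ⟨⟨s.image (val φ M), top_le_iff.mp fun w _ => ?_⟩⟩
  have key (v : CornerModule φ M) :
      val φ M v ∈ Submodule.span B ((s.image (val φ M) : Finset M) : Set M) := by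
    have hv : v ∈ Submodule.span R (s : Set (CornerModule φ M)) := hs ▸ trivial
    induction hv using Submodule.span_induction with
    | zero => simp
    | add v w _ _ hv hw => rw [map_add]; exact add_mem hv hw
    | smul a v _ hv => exact Submodule.smul_mem _ _ hv
    | mem v hv => exact Submodule.subset_span (Finset.mem_image_of_mem _ hv)
  rw [← one_smul B w, ← hxy, Finset.sum_smul]
  refine Submodule.sum_mem _ fun i _ => ?_
  rw [mul_assoc, mul_smul, mul_smul]
  exact Submodule.smul_mem _ _ (key (proj φ (y i • w)))

end IsFullCorner

/-- The `B`-module `Hom_R(f B, N)` coinduced by an `R`-module `N`. -/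
def Coinduced (φ : R →ₙₐ[k] B) (N : Type) [AddCommGroup N] [Module R N] : Type :=
  CornerModule φ B →ₗ[R] N

/-! ### Coinduced modules as preimages under `M ↦ f M` -/

namespace Coinduced

open CornerModule

variable (φ : R →ₙₐ[k] B) (N : Type) [AddCommGroup N] [Module R N]

instance : AddCommGroup (Coinduced φ N) := inferInstanceAs (AddCommGroup (_ →ₗ[R] N))

/-- Right multiplication by an element of `B` on `f B`. -/
def mulRight (b : B) : CornerModule φ B →ₗ[R] CornerModule φ B :=
  CornerModule.map φ (LinearMap.toSpanSingleton B B b)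

variable {φ N}

theorem val_mulRight (b : B) (x : CornerModule φ B) :
    val φ B (mulRight φ b x) = val φ B x * b := rfl

theorem mulRight_one : mulRight φ (1 : B) = LinearMap.id :=
  LinearMap.ext fun x => val_injective (by rw [val_mulRight, mul_one, LinearMap.id_apply])

theorem mulRight_mul (b c : B) : mulRight φ (b * c) = mulRight φ c ∘ₗ mulRight φ b :=
  LinearMap.ext fun x => val_injective (by
    rw [LinearMap.comp_apply, val_mulRight, val_mulRight, val_mulRight, mul_assoc])

theorem mulRight_add (b c : B) : mulRight φ (b + c) = mulRight φ b + mulRight φ c :=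
  LinearMap.ext fun x => val_injective (by
    rw [LinearMap.add_apply, map_add, val_mulRight, val_mulRight, val_mulRight, mul_add])

theorem mulRight_zero : mulRight φ (0 : B) = 0 :=
  LinearMap.ext fun x => val_injective (by
    rw [LinearMap.zero_apply, map_zero, val_mulRight, mul_zero])

variable (φ N) in
/-- A coinduced module consists of linear maps. -/
def toHom : Coinduced φ N ≃+ (CornerModule φ B →ₗ[R] N) := AddEquiv.refl _

/-- The action is `(b h)(x) = h(x b)`. Right multiplication reverses products, and precomposition
reverses them again, so this is a left module. -/
instance : Module B (Coinduced φ N) where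
  smul b h := (toHom φ N).symm (toHom φ N h ∘ₗ mulRight φ b)
  one_smul h := (toHom φ N).injective (by
    change toHom φ N h ∘ₗ mulRight φ 1 = _
    rw [mulRight_one, LinearMap.comp_id])
  mul_smul b c h := (toHom φ N).injective (by
    change toHom φ N h ∘ₗ mulRight φ (b * c) = (toHom φ N h ∘ₗ mulRight φ c) ∘ₗ mulRight φ b
    rw [mulRight_mul, LinearMap.comp_assoc])
  smul_zero b := rfl
  smul_add b h h' := rfl
  add_smul b c h := (toHom φ N).injective (by
    change toHom φ N h ∘ₗ mulRight φ (b + c) =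
      toHom φ N h ∘ₗ mulRight φ b + toHom φ N h ∘ₗ mulRight φ c
    rw [mulRight_add, LinearMap.comp_add])
  zero_smul h := (toHom φ N).injective (by
    change toHom φ N h ∘ₗ mulRight φ 0 = 0
    rw [mulRight_zero, LinearMap.comp_zero])

theorem toHom_smul (b : B) (h : Coinduced φ N) (x : CornerModule φ B) :
    toHom φ N (b • h) x = toHom φ N h (mulRight φ b x) := rfl

variable (φ) in
/-- The idempotent `f`, as an element of `f B`. -/
def unit : CornerModule φ B := ofFixed (φ 1) (one_mul_map φ 1)

theorem mulRight_unit (r : R) : mulRight φ (φ r) (unit φ) = r • unit φ :=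
  val_injective ((one_mul_map φ r).trans (map_mul_one φ r).symm)

variable (φ N) in
/-- Evaluation at `f`. -/
def evalUnit : CornerModule φ (Coinduced φ N) →ₗ[R] N where
  toFun h := toHom φ N (val φ _ h) (unit φ)
  map_add' h h' := by rw [map_add, map_add, LinearMap.add_apply]
  map_smul' r h := by
    rw [val_smul, toHom_smul, mulRight_unit, map_smul, RingHom.id_apply]

theorem evalUnit_apply (h : CornerModule φ (Coinduced φ N)) :
    evalUnit φ N h = toHom φ N (val φ _ h) (unit φ) := rfl

/-- For `x` in `f B` the product `x f` lies in `f B f = φ(R)`. -/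
theorem mulRight_one_eq (hφ : IsFullCorner φ) (x : CornerModule φ B) :
    ∃ r : R, mulRight φ (φ 1) x = r • unit φ := by
  obtain ⟨r, hr⟩ := hφ.exists_eq (val φ B x)
  refine ⟨r, val_injective ?_⟩
  have h : φ 1 * val φ B x = val φ B x := one_smul_val x
  change val φ B x * φ 1 = φ r * φ 1
  rw [map_mul_one, hr, h]

/-- Maps fixed by `f` factor through `x ↦ x f`, so `f Hom_R(f B, N)` is `Hom_R(f B f, N)`. As `f B
f` is free over `R` on `f`, evaluation at `f` identifies this with `N`. -/
theorem bijective_evalUnit (hφ : IsFullCorner φ) : Function.Bijective (evalUnit φ N) := by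
  constructor
  · rw [injective_iff_map_eq_zero]
    intro h hh
    refine val_injective ((toHom φ N).injective (LinearMap.ext fun x => ?_))
    obtain ⟨r, hr⟩ := mulRight_one_eq hφ x
    rw [← one_smul_val, toHom_smul, hr, map_smul, ← evalUnit_apply, hh, smul_zero]
    rfl
  · intro n
    -- The map sending `f` to `n` must be `x ↦ s(x) n`, where `x f = s(x) f`. Injectivity of `φ`
    -- makes `s(x)` unique (`hu`), and uniqueness makes `s` linear.
    choose s hs using mulRight_one_eq hφ
    have hu : Function.Injective fun r : R => r • unit φ := fun r r' h =>
      hφ.injective (by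
        have := congrArg (val φ B) h
        change φ r * φ 1 = φ r' * φ 1 at this
        rwa [map_mul_one, map_mul_one] at this)
    let h : CornerModule φ B →ₗ[R] N :=
      { toFun := fun x => s x • n
        map_add' := fun x y => by
          rw [← add_smul]
          congr 1
          refine hu ?_
          change s (x + y) • unit φ = (s x + s y) • unit φ
          rw [add_smul, ← hs, ← hs, ← hs, map_add]
        map_smul' := fun r x => by
          rw [RingHom.id_apply, smul_smul]
          congr 1
          refine hu ?_
          change s (r • x) • unit φ = (r * s x) • unit φ
          rw [mul_smul, ← hs, ← hs, map_smul] }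
    -- Idempotency of `f` gives `s(x f) = s(x)`, which is what places the map in the part fixed by
    -- `f`.
    have h1 (x : CornerModule φ B) : mulRight φ (φ 1) (mulRight φ (φ 1) x) =
        mulRight φ (φ 1) x := by
      rw [← LinearMap.comp_apply, ← mulRight_mul, ← map_mul, mul_one]
    refine ⟨ofFixed ((toHom φ N).symm h) ((toHom φ N).injective (LinearMap.ext fun x => ?_)), ?_⟩
    · rw [toHom_smul, AddEquiv.apply_symm_apply]
      change s _ • n = s x • n
      congr 1
      refine hu ?_
      change s _ • unit φ = s x • unit φ
      rw [← hs, ← hs, h1]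
    · rw [evalUnit_apply, val_ofFixed, AddEquiv.apply_symm_apply]
      have h2 : s (unit φ) = 1 := hu (by
        change s (unit φ) • unit φ = 1 • unit φ
        rw [← hs, mulRight_unit])
      change s (unit φ) • n = n
      rw [h2, one_smul]

end Coinduced

/-! ### The Morita equivalence on finitely generated modules -/

namespace IsFullCorner

variable {φ : R →ₙₐ[k] B} (hφ : IsFullCorner φ)

/-- The functor `M ↦ f M` on finitely generated modules. -/
def functor : FGModuleCat.{0} B ⥤ FGModuleCat.{0} R where
  obj M :=
    have := hφ.finite_cornerModule (M := M)
    FGModuleCat.of R (CornerModule φ M)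
  map {M N} g :=
    have := hφ.finite_cornerModule (M := M)
    have := hφ.finite_cornerModule (M := N)
    FGModuleCat.ofHom (CornerModule.map φ g.hom.hom)

instance : hφ.functor.Faithful where
  map_injective {_ _ _ _} h :=
    FGModuleCat.hom_ext (hφ.map_injective (congrArg (fun g => g.hom.hom) h))

instance : hφ.functor.Full where
  map_surjective {M N} h := by
    obtain ⟨g, hg⟩ := hφ.map_surjective (M := M) (N := N) h.hom.hom
    exact ⟨⟨ModuleCat.ofHom g⟩, FGModuleCat.hom_ext hg⟩

/-- The coinduced module is a preimage of `N`. It is finitely generated over `B` because its corner,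
being isomorphic to `N`, is finitely generated over `R`. -/
instance : hφ.functor.EssSurj where
  mem_essImage N := by
    let e : CornerModule φ (Coinduced φ N) ≃ₗ[R] N :=
      LinearEquiv.ofBijective _ (Coinduced.bijective_evalUnit hφ)
    have : Module.Finite R (CornerModule φ (Coinduced φ N)) := Module.Finite.equiv e.symm
    have := hφ.finite_of_cornerModule (M := Coinduced φ N)
    exact ⟨FGModuleCat.of B (Coinduced φ N), ⟨e.toFGModuleCatIso⟩⟩

instance : hφ.functor.IsEquivalence where

instance : hφ.functor.Additive where
  map_add := rfl

instance : hφ.functor.Linear k where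
  map_smul {M _} g c := FGModuleCat.hom_ext <| LinearMap.ext fun x : CornerModule φ M =>
    CornerModule.val_injective (CornerModule.algebraMap_smul_val c (CornerModule.map φ g.hom.hom x))

end IsFullCorner
end Corner

/-! ## The universal property of `Π^lam(Ã_n)` -/

namespace PathAlgebra

variable {k : Type} [Field k] {V : Type} [Fintype V] [Quiver.{0} V] {A : Type} [Ring A]
  [Algebra k A]

/-- An algebra homomorphism out of a path algebra is given by the images of the trivial paths and
of the arrows. -/
noncomputable def lift (E : V → A) (x : ∀ i j : V, (i ⟶ j) → A)
    (h1 : ∀ i, E i * E i = E i) (h2 : ∀ i j, i ≠ j → E i * E j = 0) (h3 : ∑ i, E i = 1)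
    (h4 : ∀ i j a, E j * x i j a = x i j a) (h5 : ∀ i j a, x i j a * E i = x i j a) :
    PathAlgebra k V →ₐ[k] A :=
  RingQuot.liftAlgHom k ⟨FreeAlgebra.lift k fun g => match g with
    | .idem i => E i
    | .arrow a => x _ _ a, by
    intro _ _ h
    cases h with
    | idem_mul_self i => simpa using h1 i
    | idem_mul_idem h => simpa using h2 _ _ h
    | sum_idem => simpa using h3
    | target a => simpa using h4 _ _ a
    | source a => simpa using h5 _ _ a⟩

variable {E : V → A} {x : ∀ i j : V, (i ⟶ j) → A}
    (h1 : ∀ i, E i * E i = E i) (h2 : ∀ i j, i ≠ j → E i * E j = 0) (h3 : ∑ i, E i = 1)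
    (h4 : ∀ i j a, E j * x i j a = x i j a) (h5 : ∀ i j a, x i j a * E i = x i j a)

theorem lift_e (i : V) : lift (k := k) E x h1 h2 h3 h4 h5 (e k i) = E i :=
  (RingQuot.liftAlgHom_mkAlgHom_apply k _ _ _).trans (by rw [FreeAlgebra.lift_ι_apply])

theorem lift_arrow {i j : V} (a : i ⟶ j) :
    lift (k := k) E x h1 h2 h3 h4 h5 (arrow k a) = x i j a :=
  (RingQuot.liftAlgHom_mkAlgHom_apply k _ _ _).trans (by rw [FreeAlgebra.lift_ι_apply])

end PathAlgebra

namespace CyclicQuiver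

open PathAlgebra DeformedPreprojective

variable {n : ℕ} (lam : CyclicQuiver n → ℂ)

theorem exists_algHom {A : Type} [Ring A] [Algebra ℂ A] (E' x y : CyclicQuiver n → A)
    (h1 : ∀ i, E' i * E' i = E' i) (h2 : ∀ i j, i ≠ j → E' i * E' j = 0) (h3 : ∑ i, E' i = 1)
    (hx : ∀ i, E' (i + 1) * x i = x i) (hx' : ∀ i, x i * E' i = x i)
    (hy : ∀ i, E' i * y i = y i) (hy' : ∀ i, y i * E' (i + 1) = y i)
    (hrel : ∀ i, y (i + 1) * x (i + 1) - x i * y i + lam (i + 1) • E' (i + 1) = 0) :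
    ∃ ρ : DeformedPreprojective ℂ (CyclicQuiver n) lam →ₐ[ℂ] A,
      (∀ i, ρ (E lam i) = E' i) ∧ (∀ i, ρ (al lam i) = x i) ∧ ∀ i, ρ (be lam i) = y i := by
  let z : ∀ i j : Quiver.Symmetrify (CyclicQuiver n), (i ⟶ j) → A := fun i j a =>
    match a with
    | Sum.inl _ => x i
    | Sum.inr _ => y j
  have h4 : ∀ i j a, E' j * z i j a = z i j a := by
    rintro i j (⟨⟨rfl⟩⟩ | ⟨⟨rfl⟩⟩)
    · exact hx i
    · exact hy j
  have h5 : ∀ i j a, z i j a * E' i = z i j a := by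
    rintro i j (⟨⟨rfl⟩⟩ | ⟨⟨rfl⟩⟩)
    · exact hx' i
    · exact hy' j
  let τ : PathAlgebra ℂ (Quiver.Symmetrify (CyclicQuiver n)) →ₐ[ℂ] A :=
    PathAlgebra.lift (V := Quiver.Symmetrify (CyclicQuiver n)) E' z h1 h2 h3 h4 h5
  have hE (i : CyclicQuiver n) : τ (de ℂ i) = E' i :=
    lift_e (V := Quiver.Symmetrify (CyclicQuiver n)) h1 h2 h3 h4 h5 i
  have ha {i j : CyclicQuiver n} (a : i ⟶ j) : τ (darrow ℂ a) = x i :=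
    lift_arrow (V := Quiver.Symmetrify (CyclicQuiver n)) h1 h2 h3 h4 h5 (i := i) (j := j)
      (Sum.inl a)
  have hb {i j : CyclicQuiver n} (a : i ⟶ j) : τ (dstar ℂ a) = y i :=
    lift_arrow (V := Quiver.Symmetrify (CyclicQuiver n)) h1 h2 h3 h4 h5 (i := j) (j := i)
      (Sum.inr a)
  let ρ : DeformedPreprojective ℂ (CyclicQuiver n) lam →ₐ[ℂ] A := RingQuot.liftAlgHom ℂ ⟨τ, by
    intro _ _ h
    obtain ⟨i⟩ := h
    -- Writing the vertex as a successor exhibits its unique incoming arrow.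
    obtain ⟨i, rfl⟩ : ∃ j, i = j + 1 := ⟨i - 1, by simp⟩
    rw [sum_out n (i + 1) (fun j a => dstar ℂ a * darrow ℂ a),
      sum_in n i (fun j a => darrow ℂ a * dstar ℂ a)]
    rw [map_add, map_sub, map_mul, map_mul, map_smul, map_zero, ha, hb, ha, hb, hE, hrel]⟩
  have hρ (u) : ρ (mk lam u) = τ u := RingQuot.liftAlgHom_mkAlgHom_apply ℂ _ _ u
  exact ⟨ρ, fun i => (hρ _).trans (hE i), fun i => (hρ _).trans (ha _), fun i => (hρ _).trans (hb _)⟩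

end CyclicQuiver

/-! ## Products of arrows -/

namespace CyclicTriple

open Polynomial
open scoped Fin.CommRing

variable {k B : Type} [Field k] [Ring B] [Algebra k B] {n : ℕ}
  {lam : Fin (n + 1) → k} {E : Fin (n + 1) → B} {a b : B}

theorem mul_pow_b (h : CyclicTriple lam E a b) (p : ℕ) (i : Fin (n + 1)) :
    E i * b ^ p = b ^ p * E (i + (p : Fin (n + 1))) := by
  induction p generalizing i with
  | zero => simp
  | succ p ih =>
    rw [pow_succ', ← mul_assoc, h.mul_b, mul_assoc, ih, mul_assoc]
    push_cast
    congr 3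
    ring

/-- `lam 0 + ⋯ + lam i`. -/
def root {k : Type} [Field k] {n : ℕ} (lam : Fin (n + 1) → k) (i : Fin (n + 1)) : k :=
  ∑ j ∈ Finset.Iic i, lam j

/-- Immediate from the definition of `zeta`: the detour along the outgoing arrow and back is a
polynomial in a central element. -/
theorem b_mul_a_mul_E (h : CyclicTriple lam E a b) (i : Fin (n + 1)) :
    b * a * E i = aeval (zeta lam E a b) (X - C (root lam i)) * E i := by
  rw [aeval_sub, aeval_X, aeval_C, sub_mul, ← Algebra.smul_def, zeta, add_mul, h.sum_mul_E, root,
    add_sub_cancel_right]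

/-- The commutation relation adds `lam (i + 1)` to the value of `b a` at `i + 1`, which turns the
root at `i + 1` into the root at `i`. Passing the last vertex uses that the total is zero. -/
theorem a_mul_b_mul_E (h : CyclicTriple lam E a b) (hlam : ∑ i, lam i = 0) (i : Fin (n + 1)) :
    a * b * E (i + 1) = aeval (zeta lam E a b) (X - C (root lam i)) * E (i + 1) := by
  have h1 : root lam (i + 1) = lam (i + 1) + root lam i := by
    simpa [root] using partial_succ hlam (i + 1)
  have h2 := h.b_mul_a_mul_E (i + 1)
  rw [aeval_sub, aeval_X, aeval_C, sub_mul, ← Algebra.smul_def] at h2 ⊢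
  rw [h.comm, add_mul, h.sum_mul_E, h2, h1, add_smul]
  abel

theorem zeta_mem_center (h : CyclicTriple lam E a b) (hlam : ∑ i, lam i = 0) :
    zeta lam E a b ∈ Subalgebra.center k B :=
  h.mem_center (h.zeta_comm_a hlam) (h.zeta_comm_b hlam) h.zeta_comm_E

theorem pow_a_mem_center (h : CyclicTriple lam E a b) (hlam : ∑ i, lam i = 0) :
    a ^ (n + 1) ∈ Subalgebra.center k B :=
  h.mem_center (Commute.pow_self a _) (h.pow_comm_b hlam) h.pow_comm_E

theorem pow_b_mem_center (h : CyclicTriple lam E a b) (hlam : ∑ i, lam i = 0) :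
    b ^ (n + 1) ∈ Subalgebra.center k B :=
  h.mem_center (by simpa using (h.opposite.pow_comm_b hlam).unop) (Commute.pow_self b _)
    (fun i => by simpa using (h.opposite.pow_comm_E i).unop)

theorem commute_aeval (h : CyclicTriple lam E a b) (hlam : ∑ i, lam i = 0) (p : k[X]) (x : B) :
    Commute (aeval (zeta lam E a b) p) x := by
  have h1 : aeval (zeta lam E a b) p ∈ Subalgebra.center k B :=
    Algebra.adjoin_le (Set.singleton_subset_iff.mpr (h.zeta_mem_center hlam))
      (aeval_mem_adjoin_singleton k _)
  exact (Subalgebra.mem_center_iff.mp h1 x).symm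

theorem pow_b_mul_E (h : CyclicTriple lam E a b) (p : ℕ) (i : Fin (n + 1)) :
    b ^ p * E i = E (i - (p : Fin (n + 1))) * b ^ p := by
  rw [h.mul_pow_b, sub_add_cancel]

/-- In the path `m + 1` steps forward and back, the innermost `b a` sits at vertex `i + m`. It is
replaced by a central factor, and a shorter round trip remains. -/
theorem pow_b_mul_pow_a (h : CyclicTriple lam E a b) (hlam : ∑ i, lam i = 0) (m : ℕ)
    (i : Fin (n + 1)) :
    b ^ m * a ^ m * E i = aeval (zeta lam E a b)
      (∏ j ∈ Finset.range m, (X - C (root lam (i + (j : Fin (n + 1)))))) * E i := by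
  induction m with
  | zero => simp
  | succ m ih =>
    rw [Finset.prod_range_succ, mul_comm (Finset.prod _ _), map_mul, mul_assoc (aeval _ _), ← ih, pow_succ,
      pow_succ']
    calc b ^ m * b * (a * a ^ m) * E i = b ^ m * (b * a * (a ^ m * E i)) := by
          simp only [mul_assoc]
      _ = b ^ m * (b * a * E (i + (m : Fin (n + 1))) * a ^ m) := by
          rw [h.pow_mul_E]; simp only [mul_assoc]
      _ = _ := by
          rw [h.b_mul_a_mul_E, mul_assoc, ← h.pow_mul_E, ← mul_assoc,
            ← (h.commute_aeval hlam _ (b ^ m)).eq]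
          simp only [mul_assoc]

/-- The mirror image: the innermost `a b` of a backward round trip contributes the root of the
vertex just before the one where it sits, whence the shift by `1` in the indices. -/
theorem pow_a_mul_pow_b (h : CyclicTriple lam E a b) (hlam : ∑ i, lam i = 0) (m : ℕ)
    (i : Fin (n + 1)) :
    a ^ m * b ^ m * E i = aeval (zeta lam E a b)
      (∏ j ∈ Finset.range m, (X - C (root lam (i - 1 - (j : Fin (n + 1)))))) * E i := by
  induction m with
  | zero => simp
  | succ m ih =>
    -- The turning vertex is written as a successor, the form required by `a_mul_b_mul_E`.
    have h1 : i - (m : Fin (n + 1)) = i - 1 - (m : Fin (n + 1)) + 1 := by ring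
    rw [Finset.prod_range_succ, mul_comm (Finset.prod _ _), map_mul, mul_assoc (aeval _ _), ← ih, pow_succ,
      pow_succ']
    calc a ^ m * a * (b * b ^ m) * E i = a ^ m * (a * b * (b ^ m * E i)) := by
          simp only [mul_assoc]
      _ = a ^ m * (a * b * E (i - 1 - (m : Fin (n + 1)) + 1) * b ^ m) := by
          rw [h.pow_b_mul_E, h1]; simp only [mul_assoc]
      _ = _ := by
          rw [h.a_mul_b_mul_E hlam, mul_assoc, ← h1, ← h.pow_b_mul_E, ← mul_assoc,
            ← (h.commute_aeval hlam _ (a ^ m)).eq]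
          simp only [mul_assoc]

/-- A round trip of length `n + 1` meets every root exactly once, whatever its starting vertex. This
is the equation `X Y = P(Z)` up to the leading coefficient. -/
theorem pow_a_mul_pow_b_eq (h : CyclicTriple lam E a b) (hlam : ∑ i, lam i = 0) :
    a ^ (n + 1) * b ^ (n + 1) = aeval (zeta lam E a b) (∏ i, (X - C (root lam i))) := by
  conv_lhs => rw [← mul_one (_ * _), ← h.sum_idem, Finset.mul_sum]
  conv_rhs => rw [← mul_one (aeval _ _), ← h.sum_idem, Finset.mul_sum]
  refine Finset.sum_congr rfl fun i _ => ?_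
  rw [h.pow_a_mul_pow_b hlam,
    ← Fin.prod_univ_eq_prod_range (fun j => X - C (root lam (i - 1 - (j : Fin (n + 1)))))]
  simp only [Fin.cast_val_eq_self]
  congr 2
  exact Fintype.prod_equiv (Equiv.subLeft (i - 1)) _ _ fun _ => rfl

/-- `B` is spanned by the paths along the arrows `a` only or `b` only, over polynomials in the
central element `zeta`. -/
theorem mem_span_paths (h : CyclicTriple lam E a b) (hlam : ∑ i, lam i = 0) (x : B) :
    x ∈ AddSubgroup.closure {y | ∃ (p : k[X]) (m : ℕ) (i : Fin (n + 1)),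
      y = aeval (zeta lam E a b) p * (a ^ m * E i) ∨
        y = aeval (zeta lam E a b) p * (b ^ m * E i)} := by
  set S := AddSubgroup.closure {y | ∃ (p : k[X]) (m : ℕ) (i : Fin (n + 1)),
      y = aeval (zeta lam E a b) p * (a ^ m * E i) ∨
        y = aeval (zeta lam E a b) p * (b ^ m * E i)} with hS
  have hSa (p : k[X]) (m : ℕ) (i : Fin (n + 1)) :
      aeval (zeta lam E a b) p * (a ^ m * E i) ∈ S :=
    AddSubgroup.subset_closure ⟨p, m, i, Or.inl rfl⟩
  have hSb (p : k[X]) (m : ℕ) (i : Fin (n + 1)) :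
      aeval (zeta lam E a b) p * (b ^ m * E i) ∈ S :=
    AddSubgroup.subset_closure ⟨p, m, i, Or.inr rfl⟩
  -- Polynomials in `zeta` are central, so stability under `y` need only be tested on pure paths.
  have stab (y : B) (hya : ∀ m i, y * (a ^ m * E i) ∈ S) (hyb : ∀ m i, y * (b ^ m * E i) ∈ S)
      (hyp : ∀ (p : k[X]), ∀ s ∈ S, aeval (zeta lam E a b) p * s ∈ S) :
      ∀ s ∈ S, y * s ∈ S := by
    intro s hs
    rw [hS] at hs
    induction hs using AddSubgroup.closure_induction with
    | mem s hs =>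
      obtain ⟨p, m, i, rfl | rfl⟩ := hs
      · rw [← mul_assoc, ← (h.commute_aeval hlam p y).eq, mul_assoc]
        exact hyp p _ (hya m i)
      · rw [← mul_assoc, ← (h.commute_aeval hlam p y).eq, mul_assoc]
        exact hyp p _ (hyb m i)
    | zero => rw [mul_zero]; exact S.zero_mem
    | add s t _ _ hs ht => rw [mul_add]; exact S.add_mem hs ht
    | neg s _ hs => rw [mul_neg]; exact S.neg_mem hs
  have hp (p : k[X]) : ∀ s ∈ S, aeval (zeta lam E a b) p * s ∈ S := by
    intro s hs
    rw [hS] at hs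
    induction hs using AddSubgroup.closure_induction with
    | mem s hs =>
      obtain ⟨q, m, i, rfl | rfl⟩ := hs
      · rw [← mul_assoc, ← map_mul]; exact hSa _ _ _
      · rw [← mul_assoc, ← map_mul]; exact hSb _ _ _
    | zero => rw [mul_zero]; exact S.zero_mem
    | add s t _ _ hs ht => rw [mul_add]; exact S.add_mem hs ht
    | neg s _ hs => rw [mul_neg]; exact S.neg_mem hs
  have hSa' (m : ℕ) (i : Fin (n + 1)) : a ^ m * E i ∈ S := by simpa using hSa 1 m i
  have hSb' (m : ℕ) (i : Fin (n + 1)) : b ^ m * E i ∈ S := by simpa using hSb 1 m i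
  have ha : ∀ s ∈ S, a * s ∈ S := by
    refine stab a (fun m i => ?_) (fun m i => ?_) hp
    · rw [← mul_assoc, ← pow_succ']; exact hSa' _ _
    · cases m with
      | zero => simpa using hSa' 1 i
      | succ m =>
        -- A turn `a b` at the end of the path becomes a polynomial in `zeta`, leaving a shorter
        -- pure path.
        have h1 : i - (m : Fin (n + 1)) = i - 1 - (m : Fin (n + 1)) + 1 := by ring
        rw [pow_succ', mul_assoc, h.pow_b_mul_E, h1, ← mul_assoc, ← mul_assoc,
          h.a_mul_b_mul_E hlam, ← h1, mul_assoc, ← h.pow_b_mul_E]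
        exact hSb _ _ _
  have hb : ∀ s ∈ S, b * s ∈ S := by
    refine stab b (fun m i => ?_) (fun m i => ?_) hp
    · cases m with
      | zero => simpa using hSb' 1 i
      | succ m =>
        rw [pow_succ', mul_assoc, h.pow_mul_E, ← mul_assoc, ← mul_assoc,
          h.b_mul_a_mul_E, mul_assoc, ← h.pow_mul_E]
        exact hSa _ _ _
    · rw [← mul_assoc, ← pow_succ']; exact hSb' _ _
  have hE (j : Fin (n + 1)) : ∀ s ∈ S, E j * s ∈ S := by
    refine stab (E j) (fun m i => ?_) (fun m i => ?_) hp
    · by_cases hj : j = i + (m : Fin (n + 1))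
      · rw [h.pow_mul_E, ← mul_assoc, hj, h.idem, ← h.pow_mul_E]; exact hSa' _ _
      · rw [h.pow_mul_E, ← mul_assoc, h.orth _ _ hj, zero_mul]; exact S.zero_mem
    · by_cases hj : j = i - (m : Fin (n + 1))
      · rw [h.pow_b_mul_E, ← mul_assoc, hj, h.idem, ← h.pow_b_mul_E]; exact hSb' _ _
      · rw [h.pow_b_mul_E, ← mul_assoc, h.orth _ _ hj, zero_mul]; exact S.zero_mem
  have h1 : (1 : B) ∈ S := by
    rw [← h.sum_idem]
    exact S.sum_mem fun i _ => by simpa using hSa' 0 i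
  have hx : x ∈ Algebra.adjoin k (insert a (insert b (Set.range E))) := by
    rw [h.adjoin]; trivial
  suffices H : ∀ s ∈ S, x * s ∈ S by simpa using H 1 h1
  refine Algebra.adjoin_induction (p := fun x _ => ∀ s ∈ S, x * s ∈ S) ?_ ?_ ?_ ?_ hx
  · rintro y (rfl | rfl | ⟨i, rfl⟩)
    · exact ha
    · exact hb
    · exact hE i
  · intro r s hs
    simpa using hp (C r) s hs
  · intro y z _ _ hy hz s hs; rw [add_mul]; exact S.add_mem (hy s hs) (hz s hs)
  · intro y z _ _ hy hz s hs; rw [mul_assoc]; exact hy _ (hz s hs)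

/-- The corner at a vertex is spanned by the cycles. -/
theorem exists_aeval_of_corner (h : CyclicTriple lam E a b) (hlam : ∑ i, lam i = 0)
    (S : Subalgebra k B) (hz : zeta lam E a b ∈ S) (ha : a ^ (n + 1) ∈ S) (hb : b ^ (n + 1) ∈ S)
    (j : Fin (n + 1)) (x : B) : ∃ s ∈ S, E j * x * E j = s * E j := by
  have hp (p : k[X]) : aeval (zeta lam E a b) p ∈ S :=
    Algebra.adjoin_le (Set.singleton_subset_iff.mpr hz) (aeval_mem_adjoin_singleton k _)
  have key {p : k[X]} {y : B} (hy : ∃ s ∈ S, E j * y * E j = s * E j) :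
      ∃ s ∈ S, E j * (aeval (zeta lam E a b) p * y) * E j = s * E j := by
    obtain ⟨s, hs, hys⟩ := hy
    refine ⟨aeval (zeta lam E a b) p * s, S.mul_mem (hp p) hs, ?_⟩
    rw [← mul_assoc, ← (h.commute_aeval hlam p (E j)).eq, mul_assoc _ s, ← hys]
    simp only [mul_assoc]
  induction h.mem_span_paths hlam x using AddSubgroup.closure_induction with
  | zero => exact ⟨0, S.zero_mem, by simp⟩
  | add x y _ _ hx hy =>
    obtain ⟨s, hs, hx⟩ := hx
    obtain ⟨t, ht, hy⟩ := hy
    exact ⟨s + t, S.add_mem hs ht, by rw [mul_add, add_mul, hx, hy, add_mul]⟩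
  | neg x _ hx =>
    obtain ⟨s, hs, hx⟩ := hx
    exact ⟨-s, S.neg_mem hs, by rw [mul_neg, neg_mul, hx, neg_mul]⟩
  | mem x hx =>
    obtain ⟨p, m, i, rfl | rfl⟩ := hx
    · refine key ?_
      -- The product with `E j` on both sides vanishes unless `i = j` and `n + 1` divides `m`; in
      -- that case the path is a power of the full cycle.
      by_cases hij : i = j
      · subst hij
        by_cases hm : (m : Fin (n + 1)) = 0
        · obtain ⟨l, rfl⟩ := (Fin.natCast_eq_zero).mp hm
          exact ⟨(a ^ (n + 1)) ^ l, S.pow_mem ha l, by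
            rw [mul_assoc, mul_assoc, h.idem, h.pow_mul_E, hm, add_zero, ← mul_assoc, h.idem,
              ← pow_mul]
            simpa [hm] using (h.pow_mul_E ((n + 1) * l) i).symm⟩
        · exact ⟨0, S.zero_mem, by
            rw [h.pow_mul_E, ← mul_assoc, h.orth _ _ (by simpa using hm), zero_mul, zero_mul]⟩
      · exact ⟨0, S.zero_mem, by
          rw [mul_assoc, mul_assoc, h.orth _ _ hij, mul_zero, mul_zero, zero_mul]⟩
    · refine key ?_
      by_cases hij : i = j
      · subst hij
        by_cases hm : (m : Fin (n + 1)) = 0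
        · obtain ⟨l, rfl⟩ := (Fin.natCast_eq_zero).mp hm
          exact ⟨(b ^ (n + 1)) ^ l, S.pow_mem hb l, by
            rw [mul_assoc, mul_assoc, h.idem, h.pow_b_mul_E, hm, sub_zero, ← mul_assoc, h.idem,
              ← pow_mul]
            simpa [hm] using (h.pow_b_mul_E ((n + 1) * l) i).symm⟩
        · exact ⟨0, S.zero_mem, by
            rw [h.pow_b_mul_E, ← mul_assoc, h.orth _ _ (fun h0 => hm (sub_eq_self.mp h0.symm)), zero_mul,
              zero_mul]⟩
      · exact ⟨0, S.zero_mem, by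
          rw [mul_assoc, mul_assoc, h.orth _ _ hij, mul_zero, mul_zero, zero_mul]⟩

end CyclicTriple

namespace CyclicTriple

open Polynomial
open scoped Fin.CommRing

variable {k B : Type} [Field k] [Ring B] [Algebra k B] {n : ℕ}
  {lam : Fin (n + 1) → k} {E : Fin (n + 1) → B} {a b : B}

/-! ## The idempotent of the last vertex is full -/

/-- From `i` the last vertex is reached by `n - i` steps forward or by `i + 1` steps backward. The
round trips involve the roots at `i, …, n - 1` and at `i - 1, …, 0, n`, respectively. These are
disjoint sets, so distinct roots give coprime polynomials, and a Bézout relation writes `E i`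
through the last idempotent. -/
theorem exists_E_eq (h : CyclicTriple lam E a b) (hlam : ∑ i, lam i = 0)
    (hinj : Function.Injective (root lam)) (i : Fin (n + 1)) :
    ∃ x y x' y' : B, x * E (Fin.last n) * y + x' * E (Fin.last n) * y' = E i := by
  have hco : IsCoprime (∏ j ∈ Finset.range (n - i), (X - C (root lam (i + (j : Fin (n + 1))))))
      (∏ j ∈ Finset.range (i + 1), (X - C (root lam (i - 1 - (j : Fin (n + 1)))))) := by
    refine IsCoprime.prod_left fun j hj => IsCoprime.prod_right fun l hl => ?_
    refine isCoprime_X_sub_C_of_isUnit_sub (IsUnit.mk0 _ (sub_ne_zero.mpr (hinj.ne fun hjl => ?_)))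
    -- A common root would make `n + 1` divide `j + l + 1`, which lies between `1` and `n`.
    have h1 : ((j + l + 1 : ℕ) : Fin (n + 1)) = 0 := by
      push_cast
      linear_combination hjl
    rw [Fin.natCast_eq_zero] at h1
    have := Nat.le_of_dvd (by omega) h1
    rw [Finset.mem_range] at hj hl
    omega
  obtain ⟨u, v, huv⟩ := hco
  have h1 : i + ((n - i : ℕ) : Fin (n + 1)) = Fin.last n := by
    rw [Nat.cast_sub (by omega)]
    simp
  have h2 : i - ((i + 1 : ℕ) : Fin (n + 1)) = Fin.last n := by
    push_cast
    rw [sub_add_cancel_left, eq_comm, eq_neg_iff_add_eq_zero]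
    simp
  refine ⟨aeval (zeta lam E a b) u * b ^ (n - i : ℕ), a ^ (n - i : ℕ),
    aeval (zeta lam E a b) v * a ^ (i + 1 : ℕ), b ^ (i + 1 : ℕ), ?_⟩
  have h3 := h.pow_b_mul_pow_a hlam (n - i) i
  have h4 := h.pow_a_mul_pow_b hlam (i + 1) i
  rw [mul_assoc _ (E _), mul_assoc _ (E _), ← h1, ← h.pow_mul_E, h1, ← h2, ← h.pow_b_mul_E,
    mul_assoc, mul_assoc, ← mul_assoc (b ^ _), ← mul_assoc (a ^ _), h3, h4, ← mul_assoc,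
    ← mul_assoc, ← map_mul, ← map_mul, ← add_mul, ← map_add, huv, map_one, one_mul]

theorem exists_sum_eq_one (h : CyclicTriple lam E a b) (hlam : ∑ i, lam i = 0)
    (hinj : Function.Injective (root lam)) :
    ∃ (ι : Type) (_ : Fintype ι) (x y : ι → B), ∑ i, x i * E (Fin.last n) * y i = 1 := by
  choose x y x' y' hxy using h.exists_E_eq hlam hinj
  exact ⟨Fin (n + 1) ⊕ Fin (n + 1), inferInstance, Sum.elim x x', Sum.elim y y', by
    rw [Fintype.sum_sum_type, ← h.sum_idem, ← Finset.sum_add_distrib]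
    exact Finset.sum_congr rfl fun i _ => hxy i⟩

end CyclicTriple

/-! ## The ring of the Milnor fibre -/

namespace MilnorRing

open Polynomial

variable {P : ℂ[X]}

/-- The coordinate functions `X`, `Y`, `Z`. -/
noncomputable def coord (P : ℂ[X]) (i : Fin 3) : MilnorRing P := Ideal.Quotient.mk _ (.X i)

theorem coord_mul (P : ℂ[X]) : coord P 0 * coord P 1 = aeval (coord P 2) P := by
  have h1 : aeval (coord P 2) P = Ideal.Quotient.mkₐ ℂ (Ideal.span {(.X 0 * .X 1 - aeval (.X 2) P : MvPolynomial (Fin 3) ℂ)})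
        (aeval (.X 2) P) := aeval_algHom_apply (Ideal.Quotient.mkₐ ℂ _) _ _
  rw [h1]
  exact Ideal.Quotient.eq.mpr (Ideal.subset_span rfl)

/-- Homomorphisms out of `ℂ[X, Y, Z] / (X Y - P(Z))`. -/
noncomputable def lift {A : Type} [CommRing A] [Algebra ℂ A] (x y z : A) (h : x * y = aeval z P) :
    MilnorRing P →ₐ[ℂ] A :=
  Ideal.Quotient.liftₐ _ (MvPolynomial.aeval ![x, y, z]) (by
    intro r hr
    rw [← RingHom.mem_ker]
    refine (Ideal.span_le (I := RingHom.ker (MvPolynomial.aeval ![x, y, z]))).mpr ?_ hr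
    rintro _ rfl
    rw [SetLike.mem_coe, RingHom.mem_ker, map_sub, map_mul, ← aeval_algHom_apply]
    simp [h])

section

variable {A : Type} [CommRing A] [Algebra ℂ A] {x y z : A} (h : x * y = aeval z P)

theorem lift_coord (i : Fin 3) : lift x y z h (coord P i) = ![x, y, z] i :=
  (Ideal.Quotient.liftₐ_apply _ _ _ _).trans ((Ideal.Quotient.lift_mk _ _ _).trans
    (MvPolynomial.aeval_X _ _))

end

theorem algHom_ext {A : Type} [Ring A] [Algebra ℂ A] {f g : MilnorRing P →ₐ[ℂ] A}
    (h : ∀ i, f (coord P i) = g (coord P i)) : f = g :=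
  Ideal.Quotient.algHom_ext _ (MvPolynomial.algHom_ext h)

/-- If `X f = (X Y - P(Z)) g`, then the prime `X` divides `P(Z) g`. It does not divide `P(Z)`, so it
divides `g` and can be cancelled. -/
theorem eq_zero_of_coord_mul (hP : P ≠ 0) {r : MilnorRing P} (h : coord P 0 * r = 0) : r = 0 := by
  obtain ⟨f, rfl⟩ := Ideal.Quotient.mk_surjective r
  rw [coord, ← map_mul, Ideal.Quotient.eq_zero_iff_mem, Ideal.mem_span_singleton] at h
  rw [Ideal.Quotient.eq_zero_iff_mem, Ideal.mem_span_singleton]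
  obtain ⟨g, hg⟩ := h
  have h1 : (.X 0 : MvPolynomial (Fin 3) ℂ) ∣ aeval (.X 2 : MvPolynomial (Fin 3) ℂ) P * g :=
    ⟨.X 1 * g - f, by linear_combination hg⟩
  have hX : Prime (.X 0 : MvPolynomial (Fin 3) ℂ) := MvPolynomial.X_prime
  have h2 : ¬ (.X 0 : MvPolynomial (Fin 3) ℂ) ∣ aeval (.X 2 : MvPolynomial (Fin 3) ℂ) P := by
    rintro ⟨q, hq⟩
    -- Setting `X = Y = 0` kills the right-hand side but leaves `P`.
    have h3 := congrArg (MvPolynomial.aeval ![0, 0, (X : ℂ[X])]) hq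
    rw [← aeval_algHom_apply] at h3
    simp [hP] at h3
  obtain ⟨g', rfl⟩ := (hX.dvd_or_dvd h1).resolve_left h2
  exact ⟨g', mul_left_cancel₀ hX.ne_zero (by linear_combination hg)⟩

/-- Polynomials in `X` with coefficients in `ℂ[Z]`. -/
noncomputable def ofPolynomial (P : ℂ[X]) : ℂ[X][X] →+* MilnorRing P :=
  eval₂RingHom (aeval (coord P 2) : ℂ[X] →ₐ[ℂ] MilnorRing P).toRingHom (coord P 0)

/-- Each factor `Y` is absorbed by one factor `X` through `X Y = P(Z)`, so a power of `X` clears all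
`Y`. -/
theorem exists_pow_mul_eq (r : MilnorRing P) :
    ∃ (N : ℕ) (g : ℂ[X][X]), coord P 0 ^ N * r = ofPolynomial P g := by
  have hX : ofPolynomial P X = coord P 0 := by simp [ofPolynomial]
  have hC (p : ℂ[X]) : ofPolynomial P (C p) = aeval (coord P 2) p := by simp [ofPolynomial]
  obtain ⟨f, rfl⟩ := Ideal.Quotient.mk_surjective r
  induction f using MvPolynomial.induction_on with
  | C c =>
    refine ⟨0, C (C c), ?_⟩
    rw [hC, aeval_C, pow_zero, one_mul]
    rfl
  | add p q hp hq =>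
    obtain ⟨N, g, hg⟩ := hp
    obtain ⟨M, g', hg'⟩ := hq
    refine ⟨N + M, X ^ M * g + X ^ N * g', ?_⟩
    rw [map_add, map_add, map_mul, map_mul, ← hg, ← hg', map_pow, map_pow, hX]
    ring
  | mul_X p i hp =>
    obtain ⟨N, g, hg⟩ := hp
    rw [map_mul]
    change ∃ (N : ℕ) (g : ℂ[X][X]), coord P 0 ^ N * (_ * coord P i) = _
    fin_cases i
    · exact ⟨N, X * g, by rw [map_mul, ← hg, hX]; simp only [Fin.zero_eta]; ring⟩
    · refine ⟨N + 1, C P * g, ?_⟩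
      rw [map_mul, ← hg, hC, ← coord_mul]
      simp only [Fin.mk_one]
      ring
    · refine ⟨N, C X * g, ?_⟩
      rw [map_mul, ← hg, hC, aeval_X]
      simp only [Fin.reduceFinMk]
      ring

open LaurentPolynomial in
-- Some `X^N r` is a polynomial in `X` and `Z`, on which `χ` is the inclusion of polynomials into
-- Laurent polynomials. Hence `χ r = 0` forces `X^N r = 0`, and `X` is not a zero divisor.
theorem injective_of_coord (hP : P ≠ 0) (χ : MilnorRing P →ₐ[ℂ] ℂ[X][T;T⁻¹])
    (h0 : χ (coord P 0) = T 1) (h2 : χ (coord P 2) = LaurentPolynomial.C X) :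
    Function.Injective χ := by
  have hχ (g : ℂ[X][X]) : χ (ofPolynomial P g) = toLaurent g := by
    have : (χ.toRingHom.comp (ofPolynomial P)) = toLaurent := by
      refine Polynomial.ringHom_ext' (Polynomial.ringHom_ext' ?_ ?_) ?_
      · ext c
        simp [ofPolynomial]
      · simp [ofPolynomial, h2]
      · simp [ofPolynomial, h0]
    exact RingHom.congr_fun this g
  rw [injective_iff_map_eq_zero]
  intro r hr
  obtain ⟨N, g, hg⟩ := exists_pow_mul_eq r
  have hg0 : g = 0 := toLaurent_injective (by rw [← hχ, ← hg, map_mul, hr, mul_zero, map_zero])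
  rw [hg0, map_zero] at hg
  clear hg0
  induction N with
  | zero => simpa using hg
  | succ N ih => exact ih (eq_zero_of_coord_mul hP (by rw [← mul_assoc, ← pow_succ', hg]))

end MilnorRing

/-! ## A matrix representation of `Π^lam(Ã_n)` -/

namespace CyclicMatrix

open Matrix
open scoped Fin.CommRing

variable {L : Type} [CommRing L] {n : ℕ} (w : Fin (n + 1) → L)

/-- The weighted cyclic permutation matrix sending the basis vector `i` to `i + 1`. -/
def up : Matrix (Fin (n + 1)) (Fin (n + 1)) L := ∑ i, single (i + 1) i (w i)

/-- The weighted cyclic permutation matrix sending the basis vector `i + 1` to `i`. -/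
def down : Matrix (Fin (n + 1)) (Fin (n + 1)) L := ∑ i, single i (i + 1) (w i)

theorem up_mul_single (i l : Fin (n + 1)) (c : L) :
    up w * single i l c = single (i + 1) l (w i * c) := by
  rw [up, Finset.sum_mul, Finset.sum_eq_single i]
  · rw [single_mul_single_same]
  · intro j _ hj
    exact single_mul_single_of_ne _ _ _ _ hj _
  · simp

theorem down_mul_single (i l : Fin (n + 1)) (c : L) :
    down w * single i l c = single (i - 1) l (w (i - 1) * c) := by
  rw [down, Finset.sum_mul, Finset.sum_eq_single (i - 1)]
  · rw [sub_add_cancel, single_mul_single_same]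
  · intro j _ hj
    exact single_mul_single_of_ne _ _ _ _ (fun h => hj (eq_sub_of_add_eq h)) _
  · simp

theorem up_pow_mul_single (m : ℕ) (i l : Fin (n + 1)) :
    up w ^ m * single i l 1 =
      single (i + (m : Fin (n + 1))) l (∏ j ∈ Finset.range m, w (i + (j : Fin (n + 1)))) := by
  induction m with
  | zero => simp
  | succ m ih =>
    rw [pow_succ', Matrix.mul_assoc, ih, up_mul_single, Finset.prod_range_succ, mul_comm (w _)]
    push_cast
    rw [add_assoc]

theorem down_pow_mul_single (m : ℕ) (i l : Fin (n + 1)) :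
    down w ^ m * single i l 1 =
      single (i - (m : Fin (n + 1))) l (∏ j ∈ Finset.range m, w (i - 1 - (j : Fin (n + 1)))) := by
  induction m with
  | zero => simp
  | succ m ih =>
    rw [pow_succ', Matrix.mul_assoc, ih, down_mul_single, Finset.prod_range_succ, mul_comm (w _)]
    push_cast
    rw [sub_add_eq_sub_sub, sub_right_comm i]

/-- The diagonal idempotents sum to `1`, so a matrix is known from its products with them. -/
theorem eq_scalar {M : Matrix (Fin (n + 1)) (Fin (n + 1)) L} {c : L}
    (h : ∀ i, M * single i i 1 = single i i c) : M = scalar (Fin (n + 1)) c := by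
  have h1 : ∑ i : Fin (n + 1), single i i (1 : L) = 1 := sum_single_one
  rw [← mul_one M, ← h1, Finset.mul_sum, Finset.sum_congr rfl fun i _ => h i]
  rw [← mul_one (scalar _ _), ← h1, Finset.mul_sum]
  refine Finset.sum_congr rfl fun i _ => ?_
  rw [scalar_apply, ← smul_one_eq_diagonal, smul_mul, Matrix.one_mul, smul_single, smul_eq_mul,
    mul_one]

/-- Going once around returns every basis vector to its place after collecting each weight once. -/
theorem up_pow : up w ^ (n + 1) = scalar (Fin (n + 1)) (∏ i, w i) := by
  refine eq_scalar fun i => ?_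
  rw [up_pow_mul_single, Fin.natCast_self, add_zero,
    ← Fin.prod_univ_eq_prod_range (fun j => w (i + (j : Fin (n + 1))))]
  simp only [Fin.cast_val_eq_self]
  congr 1
  exact Fintype.prod_equiv (Equiv.addLeft i) _ _ fun _ => rfl

theorem down_pow : down w ^ (n + 1) = scalar (Fin (n + 1)) (∏ i, w i) := by
  refine eq_scalar fun i => ?_
  rw [down_pow_mul_single, Fin.natCast_self, sub_zero,
    ← Fin.prod_univ_eq_prod_range (fun j => w (i - 1 - (j : Fin (n + 1))))]
  simp only [Fin.cast_val_eq_self]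
  congr 1
  exact Fintype.prod_equiv (Equiv.subLeft (i - 1)) _ _ fun _ => rfl

end CyclicMatrix

namespace PiA

open Polynomial Matrix
open LaurentPolynomial (T)
open CyclicTriple (root zeta)
open scoped LaurentPolynomial Fin.CommRing

variable {n : ℕ} (lam : Fin (n + 1) → ℂ)

/-- The sum of all arrows `i → i + 1`. -/
noncomputable def a : PiA n lam :=
  ∑ i : CyclicQuiver n, CyclicQuiver.al (CyclicQuiver.weight lam) i

/-- The sum of all arrows `i + 1 → i`. -/
noncomputable def b : PiA n lam :=
  ∑ i : CyclicQuiver n, CyclicQuiver.be (CyclicQuiver.weight lam) i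

theorem cyclicTriple : CyclicTriple lam (e lam) (a lam) (b lam) :=
  CyclicQuiver.cyclicTriple (n := n) (CyclicQuiver.weight lam)

/-- The weight of the arrow `i → i + 1` in the matrix representation. -/
noncomputable def weightUp (i : Fin (n + 1)) : ℂ[X][T;T⁻¹] := if i = Fin.last n then T 1 else 1

/-- The weight of the arrow `i + 1 → i` in the matrix representation. -/
noncomputable def weightDown (i : Fin (n + 1)) : ℂ[X][T;T⁻¹] :=
  LaurentPolynomial.C (X - C (root lam i)) * if i = Fin.last n then T (-1) else 1

theorem weightUp_mul_weightDown (i : Fin (n + 1)) :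
    weightUp i * weightDown lam i = LaurentPolynomial.C (X - C (root lam i)) := by
  unfold weightUp weightDown
  split_ifs
  · rw [mul_left_comm, ← LaurentPolynomial.T_add, add_neg_cancel, LaurentPolynomial.T_zero, mul_one]
  · rw [one_mul, mul_one]

theorem prod_weightUp : ∏ i : Fin (n + 1), weightUp i = T 1 := by
  unfold weightUp
  rw [Finset.prod_ite_eq' Finset.univ (Fin.last n), if_pos (Finset.mem_univ _)]

theorem prod_weightDown : ∏ i : Fin (n + 1), weightDown lam i =
    LaurentPolynomial.C (∏ i, (X - C (root lam i))) * T (-1) := by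
  unfold weightDown
  rw [Finset.prod_mul_distrib, Finset.prod_ite_eq' Finset.univ (Fin.last n),
    if_pos (Finset.mem_univ _), map_prod]

/-- Opposite arrows have weights with product `Z - Λ_i`, so the relation at `i + 1` reads `(Z -
Λ_{i+1}) - (Z - Λ_i) + λ_{i+1} = 0`. How this product is split between the two arrows is free;
putting `T` on a single arrow makes the full cycle act as `T`, independent of `Z`. -/
theorem exists_rep (hlam : ∑ i, lam i = 0) :
    ∃ ρ : PiA n lam →ₐ[ℂ] Matrix (Fin (n + 1)) (Fin (n + 1)) ℂ[X][T;T⁻¹],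
      (∀ i, ρ (e lam i) = single i i 1) ∧ ρ (a lam) = CyclicMatrix.up weightUp ∧
        ρ (b lam) = CyclicMatrix.down (weightDown lam) := by
  have hidem (i : Fin (n + 1)) :
      single i i (1 : ℂ[X][T;T⁻¹]) * single i i 1 = single i i 1 := by
    rw [single_mul_single_same, one_mul]
  have horth (i j : Fin (n + 1)) (hij : i ≠ j) :
      single i i (1 : ℂ[X][T;T⁻¹]) * single j j 1 = 0 :=
    single_mul_single_of_ne _ _ _ _ hij _
  have htarget (i j : Fin (n + 1)) (c : ℂ[X][T;T⁻¹]) :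
      single i i 1 * single i j c = single i j c := by
    rw [single_mul_single_same, one_mul]
  have hsource (i j : Fin (n + 1)) (c : ℂ[X][T;T⁻¹]) :
      single i j c * single j j 1 = single i j c := by
    rw [single_mul_single_same, mul_one]
  have hrel (i : Fin (n + 1)) :
      single (i + 1) (i + 1 + 1) (weightDown lam (i + 1)) *
          single (i + 1 + 1) (i + 1) (weightUp (i + 1)) -
        single (i + 1) i (weightUp i) * single i (i + 1) (weightDown lam i) +
        lam (i + 1) • single (i + 1) (i + 1) 1 = 0 := by
    have h1 : root lam (i + 1) = lam (i + 1) + root lam i := by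
      simpa [root] using CyclicTriple.partial_succ hlam (i + 1)
    have h2 : lam (i + 1) • (1 : ℂ[X][T;T⁻¹]) = LaurentPolynomial.C (C (lam (i + 1))) := by
      rw [← Algebra.algebraMap_eq_smul_one]; rfl
    rw [single_mul_single_same, single_mul_single_same, mul_comm, weightUp_mul_weightDown,
      weightUp_mul_weightDown, smul_single, h2, sub_eq_add_neg, single_neg, ← single_add,
      ← single_add, h1, ← map_neg, ← map_add, ← map_add, map_add C]
    rw [show (X - (C (lam (i + 1)) + C (root lam i)) + -(X - C (root lam i)) +
      C (lam (i + 1)) : ℂ[X]) = 0 by ring, map_zero, single_zero]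
  obtain ⟨ρ, h1, h2, h3⟩ := CyclicQuiver.exists_algHom (n := n) (CyclicQuiver.weight lam)
    (A := Matrix (Fin (n + 1)) (Fin (n + 1)) ℂ[X][T;T⁻¹])
    (fun i : Fin (n + 1) => single i i 1)
    (fun i : Fin (n + 1) => single (i + 1) i (weightUp i))
    (fun i : Fin (n + 1) => single i (i + 1) (weightDown lam i))
    hidem horth sum_single_one (fun _ => htarget _ _ _) (fun _ => hsource _ _ _)
    (fun _ => htarget _ _ _) (fun _ => hsource _ _ _) hrel
  refine ⟨ρ, h1, ?_, ?_⟩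
  · exact (map_sum ρ _ _).trans (Finset.sum_congr rfl fun i _ => h2 i)
  · exact (map_sum ρ _ _).trans (Finset.sum_congr rfl fun i _ => h3 i)

variable {lam}

/-- On basis vector `i` the product `b a` acts by `Z - Λ_i`, and `zeta` adds `Λ_i` back. -/
theorem rep_zeta {ρ : PiA n lam →ₐ[ℂ] Matrix (Fin (n + 1)) (Fin (n + 1)) ℂ[X][T;T⁻¹]}
    (he : ∀ i, ρ (e lam i) = single i i 1) (ha : ρ (a lam) = CyclicMatrix.up weightUp)
    (hb : ρ (b lam) = CyclicMatrix.down (weightDown lam)) :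
    ρ (zeta lam (e lam) (a lam) (b lam)) = scalar (Fin (n + 1)) (LaurentPolynomial.C X) := by
  refine CyclicMatrix.eq_scalar fun i => ?_
  rw [← he, ← map_mul, zeta, add_mul, (cyclicTriple lam).sum_mul_E, map_add, map_mul, map_mul,
    map_smul, ha, hb, he, mul_assoc, CyclicMatrix.up_mul_single, CyclicMatrix.down_mul_single,
    add_sub_cancel_right, mul_one, mul_comm, weightUp_mul_weightDown, smul_single, ← single_add]
  have h2 : root lam i • (1 : ℂ[X][T;T⁻¹]) = LaurentPolynomial.C (C (root lam i)) := by
    rw [← Algebra.algebraMap_eq_smul_one]; rfl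
  congr 1
  change _ + root lam i • (1 : ℂ[X][T;T⁻¹]) = _
  rw [h2, ← map_add, sub_add_cancel]

/-! ## The centre and the corner -/

variable {P : ℂ[X]} {c : ℂ}

/-- The homomorphism from the ring of the Milnor fibre to the centre of `Π^lam(Ã_n)`. -/
noncomputable def toCenter (hlam : ∑ i, lam i = 0) (hP : P = C c * ∏ i, (X - C (root lam i))) :
    MilnorRing P →ₐ[ℂ] Subalgebra.center ℂ (PiA n lam) :=
  MilnorRing.lift ⟨_, (cyclicTriple lam).pow_a_mem_center hlam⟩
    (c • ⟨_, (cyclicTriple lam).pow_b_mem_center hlam⟩)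
    ⟨_, (cyclicTriple lam).zeta_mem_center hlam⟩ (by
      refine Subtype.ext ?_
      rw [hP, map_mul, aeval_C, ← Algebra.smul_def, mul_smul_comm]
      change c • (a lam ^ (n + 1) * b lam ^ (n + 1)) =
        c • (Subalgebra.center ℂ (PiA n lam)).val (aeval _ _)
      rw [(cyclicTriple lam).pow_a_mul_pow_b_eq hlam, ← aeval_algHom_apply]
      rfl)

variable (hlam : ∑ i, lam i = 0) (hP : P = C c * ∏ i, (X - C (root lam i)))

theorem toCenter_coord_zero : (toCenter hlam hP (MilnorRing.coord P 0) : PiA n lam) =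
    a lam ^ (n + 1) :=
  congrArg Subtype.val (MilnorRing.lift_coord _ 0)

theorem toCenter_coord_one : (toCenter hlam hP (MilnorRing.coord P 1) : PiA n lam) =
    c • b lam ^ (n + 1) :=
  congrArg Subtype.val (MilnorRing.lift_coord _ 1)

theorem toCenter_coord_two : (toCenter hlam hP (MilnorRing.coord P 2) : PiA n lam) =
    zeta lam (e lam) (a lam) (b lam) :=
  congrArg Subtype.val (MilnorRing.lift_coord _ 2)

/-- The homomorphism from the ring of the Milnor fibre to the corner at the vertex `j`. -/
noncomputable def toCorner (j : Fin (n + 1)) : MilnorRing P →ₙₐ[ℂ] PiA n lam where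
  toFun r := toCenter hlam hP r * e lam j
  map_smul' x r := by
    rw [map_smul, MonoidHom.id_apply, ← smul_mul_assoc]
    rfl
  map_zero' := by rw [map_zero]; exact zero_mul _
  map_add' r s := by rw [map_add]; exact add_mul _ _ _
  map_mul' r s := by
    have h := Subalgebra.mem_center_iff.mp (toCenter hlam hP s).2 (e lam j)
    rw [map_mul, mul_assoc, ← mul_assoc (e lam j), h, mul_assoc _ (e lam j),
      (cyclicTriple lam).idem, ← mul_assoc]
    rfl

theorem toCorner_apply (j : Fin (n + 1)) (r : MilnorRing P) :
    toCorner hlam hP j r = toCenter hlam hP r * e lam j := rfl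

theorem toCorner_one (j : Fin (n + 1)) : toCorner hlam hP j 1 = e lam j := by
  rw [toCorner_apply, map_one]
  exact one_mul _

/-- In the matrix representation the central image of `r` acts as the scalar `χ r`, where `χ` embeds
the Milnor ring in `ℂ[Z][T, T⁻¹]`. After multiplication by the idempotent the diagonal entry at `j`
is still `χ r`. -/
theorem toCorner_injective (hc : c ≠ 0) (j : Fin (n + 1)) :
    Function.Injective (toCorner hlam hP j) := by
  obtain ⟨ρ, he, ha, hb⟩ := exists_rep lam hlam
  let χ : MilnorRing P →ₐ[ℂ] ℂ[X][T;T⁻¹] := MilnorRing.lift (T 1)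
    (LaurentPolynomial.C (C c * ∏ i, (X - C (root lam i))) * T (-1)) (LaurentPolynomial.C X) (by
      have h1 : aeval (LaurentPolynomial.C X : ℂ[X][T;T⁻¹]) P =
          LaurentPolynomial.C (aeval X P) :=
        aeval_algHom_apply (Algebra.ofId ℂ[X] ℂ[X][T;T⁻¹] |>.restrictScalars ℂ) X P
      rw [h1, aeval_X_left_apply, mul_left_comm, ← LaurentPolynomial.T_add, add_neg_cancel,
        LaurentPolynomial.T_zero, mul_one, hP])
  have h0 : χ (MilnorRing.coord P 0) = T 1 := MilnorRing.lift_coord _ 0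
  have h1 : χ (MilnorRing.coord P 1) =
    LaurentPolynomial.C (C c * ∏ i, (X - C (root lam i))) * T (-1) := MilnorRing.lift_coord _ 1
  have h2 : χ (MilnorRing.coord P 2) = LaurentPolynomial.C X := MilnorRing.lift_coord _ 2
  have hP0 : P ≠ 0 := by
    rw [hP]
    exact mul_ne_zero (C_ne_zero.mpr hc) (Finset.prod_ne_zero_iff.mpr fun i _ => X_sub_C_ne_zero _)
  have hχ : Function.Injective χ := MilnorRing.injective_of_coord hP0 χ h0 h2
  have key : (ρ.comp (Subalgebra.val _)).comp (toCenter hlam hP) =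
      (scalarAlgHom (Fin (n + 1)) ℂ).comp χ := by
    refine MilnorRing.algHom_ext fun i => ?_
    change ρ (toCenter hlam hP (MilnorRing.coord P i)) = scalar _ (χ (MilnorRing.coord P i))
    fin_cases i
    · refine (congrArg ρ (toCenter_coord_zero hlam hP)).trans ?_
      rw [map_pow, ha, CyclicMatrix.up_pow, prod_weightUp]
      exact congrArg _ h0.symm
    · refine (congrArg ρ (toCenter_coord_one hlam hP)).trans ?_
      rw [map_smul, map_pow, hb, CyclicMatrix.down_pow, prod_weightDown]
      refine Eq.trans ?_ (congrArg _ h1.symm)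
      rw [map_mul LaurentPolynomial.C, mul_assoc]
      exact (map_smul (scalarAlgHom (Fin (n + 1)) ℂ) c _).symm.trans
        (congrArg _ (Algebra.smul_def _ _))
    · refine (congrArg ρ (toCenter_coord_two hlam hP)).trans ?_
      rw [rep_zeta he ha hb]
      exact congrArg _ h2.symm
  rw [injective_iff_map_eq_zero]
  intro r hr
  refine hχ ?_
  rw [map_zero]
  have h3 : scalar (Fin (n + 1)) (χ r) * single j j 1 = 0 := by
    rw [← he, ← map_zero ρ, ← hr, toCorner_apply, map_mul]
    exact congrArg (· * _) (AlgHom.congr_fun key r).symm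
  rw [scalar_apply, ← smul_one_eq_diagonal, smul_mul, Matrix.one_mul, smul_single, smul_eq_mul,
    mul_one] at h3
  simpa using congrFun (congrFun h3 j) j

/-- The image of the Milnor ring contains `zeta` and both full cycles, which generate the corner;
`b^(n+1)` is recovered from `Y` by dividing by `c`. -/
theorem exists_toCorner_eq (hc : c ≠ 0) (j : Fin (n + 1)) (x : PiA n lam) :
    ∃ r, toCorner hlam hP j r = e lam j * x * e lam j := by
  let ψ : MilnorRing P →ₐ[ℂ] PiA n lam := (Subalgebra.val _).comp (toCenter hlam hP)
  have hb : b lam ^ (n + 1) = ψ (c⁻¹ • MilnorRing.coord P 1) := by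
    rw [map_smul]
    change _ = c⁻¹ • (toCenter hlam hP (MilnorRing.coord P 1) : PiA n lam)
    rw [toCenter_coord_one, smul_smul, inv_mul_cancel₀ hc, one_smul]
  obtain ⟨_, ⟨r, rfl⟩, h⟩ := (cyclicTriple lam).exists_aeval_of_corner hlam ψ.range
    ⟨_, toCenter_coord_two hlam hP⟩ ⟨_, toCenter_coord_zero hlam hP⟩ ⟨_, hb.symm⟩ j x
  exact ⟨r, h.symm⟩

include hlam hP in
theorem nonempty_corner_algEquiv (hc : c ≠ 0) (j : Fin (n + 1)) :
    Nonempty ((isIdempotentElem_e lam j).Corner ≃ₐ[ℂ] MilnorRing P) := by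
  have hmem (r : MilnorRing P) :
      toCorner hlam hP j r ∈ NonUnitalRing.corner (e lam j) := by
    refine (Subsemigroup.mem_corner_iff (isIdempotentElem_e lam j)).mpr ?_
    rw [← toCorner_one hlam hP]
    exact ⟨by rw [← map_mul, one_mul], by rw [← map_mul, mul_one]⟩
  let f : MilnorRing P →ₐ[ℂ] (isIdempotentElem_e lam j).Corner :=
    { toFun := fun r => ⟨toCorner hlam hP j r, hmem r⟩
      map_one' := Subtype.ext (toCorner_one hlam hP j)
      map_mul' := fun r s => Subtype.ext (map_mul _ r s)
      map_zero' := Subtype.ext (map_zero _)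
      map_add' := fun r s => Subtype.ext (map_add _ r s)
      commutes' := fun x => Subtype.ext (by
        change toCorner hlam hP j (algebraMap ℂ _ x) = x • e lam j
        rw [Algebra.algebraMap_eq_smul_one, map_smul, toCorner_one]) }
  refine ⟨(AlgEquiv.ofBijective f ⟨fun r s h => ?_, fun x => ?_⟩).symm⟩
  · exact toCorner_injective hlam hP hc j (congrArg Subtype.val h)
  · obtain ⟨r, hr⟩ := exists_toCorner_eq hlam hP hc j x.1
    have hx := (Subsemigroup.mem_corner_iff (isIdempotentElem_e lam j)).mp x.2
    exact ⟨r, Subtype.ext (by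
      change toCorner hlam hP j r = x.1
      rw [hr, hx.1, hx.2])⟩

theorem isFullCorner (hc : c ≠ 0) (hinj : Function.Injective (root lam)) :
    IsFullCorner (toCorner hlam hP (Fin.last n)) where
  injective := toCorner_injective hlam hP hc _
  exists_eq x := by
    rw [toCorner_one]
    exact exists_toCorner_eq hlam hP hc _ x
  exists_sum := by
    rw [toCorner_one]
    exact (cyclicTriple lam).exists_sum_eq_one hlam hinj

end PiA

/-- The opposite of a full corner that is commutative. -/
theorem IsFullCorner.op {k R B : Type} [Field k] [CommRing R] [Algebra k R] [Ring B] [Algebra k B]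
    {φ : R →ₙₐ[k] B} (hφ : IsFullCorner φ) : ∃ φ' : R →ₙₐ[k] Bᵐᵒᵖ, IsFullCorner φ' := by
  let φ' : R →ₙₐ[k] Bᵐᵒᵖ :=
    { toFun := fun r => MulOpposite.op (φ r)
      map_smul' := fun c r => by rw [map_smul]; rfl
      map_zero' := by rw [map_zero]; rfl
      map_add' := fun r s => by rw [map_add]; rfl
      -- Commutativity of `R` compensates for the reversed product in the opposite ring.
      map_mul' := fun r s => by rw [mul_comm, map_mul]; rfl }
  refine ⟨φ', fun r s h => hφ.injective (MulOpposite.op_injective h), fun x => ?_, ?_⟩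
  · obtain ⟨r, hr⟩ := hφ.exists_eq x.unop
    exact ⟨r, MulOpposite.unop_injective (hr.trans (mul_assoc _ _ _))⟩
  · obtain ⟨ι, _, x, y, hxy⟩ := hφ.exists_sum
    refine ⟨ι, inferInstance, fun i => MulOpposite.op (y i), fun i => MulOpposite.op (x i), ?_⟩
    refine MulOpposite.unop_injective ?_
    rw [MulOpposite.unop_one, ← hxy, Finset.unop_sum]
    exact Finset.sum_congr rfl fun i _ => (mul_assoc _ _ _).symm

/-! ## Derived equivalences -/

namespace AlgebraicGeometry.Coh

theorem isEquivalence_tilde (R : CommRingCat.{0}) : (tilde R).IsEquivalence := inferInstance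

theorem additive_tilde (R : CommRingCat.{0}) [IsNoetherianRing R] : (tilde R).Additive where
  map_add {_ _ f g} := (incl (Spec R)).map_injective
    (show (tildeIncl R).map (f + g) = (tildeIncl R).map f + (tildeIncl R).map g from
      (tildeIncl R).map_add)

/-- The effect of `tilde` on morphisms is determined by global sections. -/
theorem eq_smul_of_tilde {R : CommRingCat.{0}} {M N : FGModuleCat R} (f g : M ⟶ N) (r : R)
    (h : ∀ x, ((modulesSpecToSheaf.map ((tildeIncl R).map g)).1.app (.op ⊤)).hom x =
      r • ((modulesSpecToSheaf.map ((tildeIncl R).map f)).1.app (.op ⊤)).hom x) (x : M) :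
    g.hom.hom x = r • f.hom.hom x := by
  have key (g : M ⟶ N) (x : M) :
      ((modulesSpecToSheaf.map ((tildeIncl R).map g)).1.app (.op ⊤)).hom
        ((tilde.toOpen M.obj ⊤).hom x) = (tilde.toOpen N.obj ⊤).hom (g.hom.hom x) :=
    LinearMap.congr_fun (congrArg ModuleCat.Hom.hom (tilde.toOpen_map_app g.hom ⊤)) x
  -- A module is identified with the global sections of its sheaf.
  have hN : Function.Injective (tilde.toOpen N.obj ⊤).hom :=
    (ModuleCat.mono_iff_injective _).mp (inferInstanceAs (Mono (tilde.isoTop N.obj).hom))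
  refine hN ?_
  exact (key g x).symm.trans ((h _).trans ((congrArg (r • ·) (key f x)).trans (map_smul _ r _).symm))

variable (A : Type) [CommRing A] [IsNoetherianRing A]

/-- The coherent sheaf on `Spec A` given by a finitely generated `A`-module. -/
noncomputable def tildeOf : FGModuleCat.{0} A ⥤ Coh (Spec (.of A)) := tilde (.of A)

instance : (tildeOf A).IsEquivalence := isEquivalence_tilde (.of A)

instance : (tildeOf A).Additive := additive_tilde (.of A)

/-- Scalars on coherent sheaves are defined through sections. By fullness `c` times the image of `f`
is the image of some `g`, and comparing global sections gives `g = c f`. -/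
instance [Algebra ℂ A] : (tildeOf A).Linear ℂ where
  map_smul {M N} f c := by
    obtain ⟨g, hg⟩ := (tildeOf A).map_surjective (c • (tildeOf A).map f)
    rw [← hg]
    congr 1
    have h1 : (toPresheaf A).map ((tildeOf A).map g) = c • (toPresheaf A).map ((tildeOf A).map f) :=
      (congrArg _ hg).trans ((fullyFaithfulToPresheaf A).map_preimage _)
    have h2 := eq_smul_of_tilde (R := .of A) f g (algebraMap ℂ A c) fun x =>
      LinearMap.congr_fun (congrArg ModuleCat.Hom.hom (NatTrans.congr_app h1 (.op ⊤))) x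
    exact FGModuleCat.hom_ext (LinearMap.ext fun x => (h2 x).symm)

end AlgebraicGeometry.Coh

/-- A linear equivalence of abelian categories induces an equivalence of bounded derived
categories in the opposite direction. -/
theorem BoundedDerivedEquivalent.of_functor_inv (k : Type) [Field k]
    {C : Type 1} [Category.{0} C] [Abelian C] [Linear k C]
    {D : Type 1} [Category.{0} D] [Abelian D] [Linear k D]
    (F : C ⥤ D) [hA : F.Additive] [hL : F.Linear k] [F.IsEquivalence] :
    BoundedDerivedEquivalent k D C :=
  have : F.asEquivalence.functor.Additive := hA
  have : F.asEquivalence.functor.Linear k := hL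
  have : F.asEquivalence.inverse.Additive := inferInstance
  .of_functor k F.asEquivalence.inverse

/-! ### Interval sums of the parameters and distinct roots -/

namespace CyclicTriple

/-- `lam l + ⋯ + lam k`, for `l ≤ k`, is a difference of two roots. -/
theorem forall_sum_Icc_ne_zero_iff {k : Type} [Field k] {n : ℕ} (lam : Fin (n + 1) → k)
    (hlam : ∑ i, lam i = 0) :
    (∀ l m : Fin (n + 1), l ≤ m → m < Fin.last n → ∑ i ∈ Finset.Icc l m, lam i ≠ 0) ↔
      Function.Injective (root lam) := by
  have h1 (l m : Fin (n + 1)) (hlm : l < m) :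
      root lam m = root lam l + ∑ i ∈ Finset.Ioc l m, lam i := by
    rw [root, root, ← Finset.sum_union]
    · congr 1
      ext i
      simp only [Finset.mem_Iic, Finset.mem_union, Finset.mem_Ioc]
      omega
    · rw [Finset.disjoint_left]
      intro i hi hi'
      rw [Finset.mem_Iic] at hi
      rw [Finset.mem_Ioc] at hi'
      omega
  have h2 (m : Fin (n + 1)) : ∑ i ∈ Finset.Icc 0 m, lam i = root lam m := rfl
  have h3 : root lam (Fin.last n) = 0 := by
    rw [← hlam, root]
    congr 1
    ext i
    simp [Fin.le_last]
  have h4 (l : Fin n) (m : Fin (n + 1)) :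
      Finset.Ioc l.castSucc m = Finset.Icc l.succ m := by
    ext i
    simp only [Finset.mem_Ioc, Finset.mem_Icc, Fin.castSucc_lt_iff_succ_le]
  constructor
  · intro h
    have key (l m : Fin (n + 1)) (hlm : l < m) : root lam m ≠ root lam l := by
      -- An interval ending at the last vertex is not covered by the hypothesis. As the last root is
      -- `0`, the complementary interval from `0` to `l` serves instead.
      rcases eq_or_ne m (Fin.last n) with rfl | hm
      · rw [h3, ← h2]
        exact (h 0 l (Fin.zero_le _) hlm).symm
      · obtain ⟨l, rfl⟩ := Fin.eq_castSucc_of_ne_last (hlm.trans_le (Fin.le_last _)).ne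
        rw [h1 _ _ hlm, h4]
        exact fun h0 => h _ _ (Fin.castSucc_lt_iff_succ_le.mp hlm)
          (Fin.lt_last_iff_ne_last.mpr hm) (left_eq_add.mp h0.symm)
    intro l m hlm
    rcases lt_trichotomy l m with hlt | heq | hlt
    · exact absurd hlm.symm (key _ _ hlt)
    · exact heq
    · exact absurd hlm (key _ _ hlt)
  · intro h l m hlm hm h0
    -- An interval starting at `0` has no root before it; its sum is compared with the last root,
    -- which is `0`.
    rcases Fin.eq_zero_or_eq_succ l with rfl | ⟨l, rfl⟩
    · rw [h2, ← h3] at h0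
      exact hm.ne (h h0)
    · have hlt := Fin.castSucc_lt_iff_succ_le.mpr hlm
      have h5 := h1 _ _ hlt
      rw [h4, h0, add_zero] at h5
      exact hlt.ne' (h h5)

end CyclicTriple

theorem mainTheorem8 (n : ℕ) (lam : Fin (n + 1) → ℂ) (hlam : ∑ i, lam i = 0)
    (P : Polynomial ℂ) (hdeg : P.natDegree = n + 1)
    (hroots : P.roots = Finset.univ.val.map fun i : Fin (n + 1) => ∑ j ∈ Finset.Iic i, lam j) :
    Nonempty ((PiA.isIdempotentElem_e lam (Fin.last n)).Corner ≃ₐ[ℂ] MilnorRing P) ∧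
    ((∀ l k : Fin (n + 1), l ≤ k → k < Fin.last n → ∑ i ∈ Finset.Icc l k, lam i ≠ 0) ↔
      Function.Injective fun i : Fin (n + 1) => ∑ j ∈ Finset.Iic i, lam j) ∧
    ((∀ l k : Fin (n + 1), l ≤ k → k < Fin.last n → ∑ i ∈ Finset.Icc l k, lam i ≠ 0) →
      haveI := PiA.isNoetherianRing_op lam hlam
      BoundedDerivedEquivalent ℂ (FGModuleCat (MilnorRing P)) (FGModuleCat (PiA n lam)ᵐᵒᵖ) ∧
      BoundedDerivedEquivalent ℂ (AlgebraicGeometry.Coh (MilnorFibre P))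
        (FGModuleCat (PiA n lam)ᵐᵒᵖ)) := by
  have hc : P.leadingCoeff ≠ 0 := by
    rw [Polynomial.leadingCoeff_ne_zero]
    rintro rfl
    simp at hdeg
  have hP : P = Polynomial.C P.leadingCoeff *
      ∏ i, (Polynomial.X - Polynomial.C (CyclicTriple.root lam i)) := by
    -- The number of roots equals the degree, so `P` splits into the listed linear factors.
    have h := Polynomial.C_leadingCoeff_mul_prod_multiset_X_sub_C (p := P) (by
      rw [hroots, hdeg]; simp)
    rw [hroots, Multiset.map_map] at h
    exact h.symm
  have hiff := CyclicTriple.forall_sum_Icc_ne_zero_iff lam hlam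
  refine ⟨PiA.nonempty_corner_algEquiv hlam hP hc _, hiff, fun hne => ?_⟩
  have := PiA.isNoetherianRing_op lam hlam
  -- Right modules are left modules over the opposite algebra, so the full corner is transferred
  -- there.
  obtain ⟨φ, hφ⟩ := (PiA.isFullCorner hlam hP hc (hiff.mp hne)).op
  exact ⟨.of_functor_inv ℂ hφ.functor,
    .of_functor_inv ℂ (hφ.functor ⋙ AlgebraicGeometry.Coh.tildeOf (MilnorRing P))⟩
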